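/- Setting. A tabular episodic MDP with finite state set $\mathcal S$, finite action set $\mathcal A$ and horizon $H$ has an initial state $s_1$ and, for each pair $x=(s,a)\in\mathcal X=\mathcal S\times\mathcal A$, a next-state distribution $P(x)$ and a reward distribution $P_R(x)$ on $[0,1]$. Every episode starts in $s_1$ and consists of $H$ steps. A feedback graph is a directed graph $G$ on $\mathcal X$ (self-loops play no role): when the agent visits $x$ in a step, it observes, besides the transition $(x,r,s')$ it makes, one sample $(y,r_y,s'_y)$ with $r_y\sim P_R(y)$, $s'_y\sim P(y)$ for every $y$ with $x\to_G y$; all these samples are independent of each other and of the past. An algorithm chooses in every step an action, possibly at random, from the current state and everything it has observed before (in particular it may fix a policy at the beginning of each episode). Its expected regret after $T$ episodes is $T\,V^\star_1(s_1)$ minus the expected sum of all rewards it received in the $T$ episodes, where $V_1^\star(s_1)$ is the largest expected return of one episode over all deterministic time-dependent policies. A set of vertices of a directed graph is independent if there is no edge, in either direction, between two distinct members; the independence number is the size of a largest independent set. Theorem. Let $A,N,H,T$ be natural numbers with $A\ge 2$, and let $G_1$, $G_2$ be directed graphs with $NA$ and $(N+1)A$ nodes respectively (disjoint), the nodes of $G_1$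 being the state-action pairs of $N$ states and those of $G_2$ the state-action pairs of $N+1$ further states. Let $\alpha$ be the independence number of $G_1$. Suppose that $H\ge 2+2\log_A N$, $\alpha\ge 2$ and $T\ge \alpha^3/\sqrt2$. Then there is a class $\mathcal M$ of episodic MDPs with these $2N+1$ states, $A$ actions and horizon $H$ such that, with feedback graph $G_1\cup G_2=(V(G_1)\cup V(G_2),E(G_1)\cup E(G_2))$, every algorithm has, for some MDP in $\mathcal M$, expected regret after $T$ episodes at least $$\frac1{46}\sqrt{\alpha H^2T}.$$ -/

import Mathlib

open MeasureTheory ProbabilityTheory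

noncomputable section

namespace FeedbackRL

/-! ### Directed graphs -/

/-- A set of vertices is independent if there is no edge (in either direction) between two
distinct members. Self-loops play no role. -/
def IsIndependent {V : Type*} (G : Digraph V) (s : Finset V) : Prop :=
  ∀ v ∈ s, ∀ w ∈ s, v ≠ w → ¬ G.Adj v w

/-- The independence number: the size of a largest independent set. -/
def indepNumber {V : Type*} (G : Digraph V) : ℕ :=
  sSup {n : ℕ | ∃ s : Finset V, IsIndependent G s ∧ s.card = n}

/-- The union of two graphs on disjoint vertex sets `S₁ × A` and `S₂ × A`, as a graph on the
state-action pairs `(S₁ ⊕ S₂) × A`: its edges are those of `G₁` and those of `G₂`. -/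
def unionGraph {S₁ S₂ A : Type*} (G₁ : Digraph (S₁ × A)) (G₂ : Digraph (S₂ × A)) :
    Digraph ((S₁ ⊕ S₂) × A) where
  Adj x y :=
    match x, y with
    | (Sum.inl s, a), (Sum.inl t, b) => G₁.Adj (s, a) (t, b)
    | (Sum.inr s, a), (Sum.inr t, b) => G₂.Adj (s, a) (t, b)
    | _, _ => False

/-! ### Tabular episodic MDPs -/

/-- A tabular episodic MDP with state space `S` and action space `A` (the horizon is a separate
parameter below): an initial state, and for every state-action pair a distribution of the next
state and a distribution of the reward, the latter supported in `[0, 1]`. -/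
structure EpisodicMDP (S A : Type*) [MeasurableSpace S] where
  start : S
  next : S × A → Measure S
  rew : S × A → Measure ℝ
  next_prob : ∀ x, IsProbabilityMeasure (next x)
  rew_prob : ∀ x, IsProbabilityMeasure (rew x)
  rew_mem : ∀ x, ∀ᵐ r ∂(rew x), r ∈ Set.Icc (0 : ℝ) 1

/-- The agent's view of one time step: the pair `(s, a)` that was visited, and for every
state-action pair either a transition observation (reward, next state) or nothing (`Sum.inl ()`). -/
abbrev View (S A : Type*) : Type _ := (S × A) × (S × A → Unit ⊕ (ℝ × S))

/-- An algorithm: at every time step `n` (counted through all episodes) it picks an action, possibly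
at random, given its views of all earlier time steps and the current state. -/
structure Algorithm (S A : Type*) [MeasurableSpace S] [MeasurableSpace A] where
  act : (n : ℕ) → Kernel ((Fin n → View S A) × S) A
  act_markov : ∀ n, IsMarkovKernel (act n)

/-- Full record of one time step: the visited pair, and a table with one (reward, next state) sample
for every state-action pair. The agent sees only a part of the table. -/
abbrev Record (S A : Type*) : Type _ := (S × A) × (S × A → ℝ × S)

/-- The reward received in a time step: the reward sampled for the visited pair. -/
def Record.reward {S A : Type*} (w : Record S A) : ℝ := (w.2 w.1).1

/-- The state reached by a time step: the next state sampled for the visited pair. -/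
def Record.nextState {S A : Type*} (w : Record S A) : S := (w.2 w.1).2

open Classical in
/-- What the agent sees of a time step with feedback graph `G`: the visited pair `x`, and the samples
of `x` itself and of all pairs `y` with an edge from `x` to `y`. -/
def view {S A : Type*} (G : Digraph (S × A)) (w : Record S A) : View S A :=
  (w.1, fun y => if y = w.1 ∨ G.Adj w.1 y then Sum.inr (w.2 y) else Sum.inl ())

instance {S₁ S₂ : Type*} [MeasurableSpace S₁] [MeasurableSpace S₂] [DiscreteMeasurableSpace S₁]
    [DiscreteMeasurableSpace S₂] : DiscreteMeasurableSpace (S₁ ⊕ S₂) :=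
  ⟨fun _ => measurableSet_sum_iff.2 ⟨.of_discrete, .of_discrete⟩⟩

section Interaction

variable {S A : Type*} [Fintype S] [MeasurableSpace S] [DiscreteMeasurableSpace S]
  [Fintype A] [MeasurableSpace A] [DiscreteMeasurableSpace A]

theorem measurable_eval_visited :
    Measurable (fun w : Record S A => w.2 w.1) :=
  measurable_from_prod_countable_right fun x => measurable_pi_apply x

theorem measurable_nextState : Measurable (Record.nextState : Record S A → S) :=
  measurable_snd.comp measurable_eval_visited

theorem measurable_view (G : Digraph (S × A)) : Measurable (view G : Record S A → View S A) := by
  classical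
  refine measurable_fst.prodMk (measurable_pi_lambda _ fun y => ?_)
  refine Measurable.ite ?_ ?_ measurable_const
  · exact measurable_fst (MeasurableSet.of_discrete (s := {x : S × A | y = x ∨ G.Adj x y}))
  · exact measurable_inr.comp ((measurable_pi_apply y).comp measurable_snd)

/-- Law of the samples of one time step: independently for all state-action pairs `x`, a reward from
`rew x` and, independently of it, a next state from `next x`. -/
def EpisodicMDP.tableLaw (M : EpisodicMDP S A) : Measure (S × A → ℝ × S) :=
  Measure.pi fun x => (M.rew x).prod (M.next x)

/-- The current state at time step `n`, given the records of all earlier time steps. Every `H` time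
steps a new episode begins in the initial state. -/
def EpisodicMDP.currentState (M : EpisodicMDP S A) (H : ℕ) :
    (n : ℕ) → (Fin n → Record S A) → S
  | 0, _ => M.start
  | n + 1, w => if H ∣ n + 1 then M.start else (w (Fin.last n)).nextState

theorem EpisodicMDP.measurable_currentState (M : EpisodicMDP S A) (H : ℕ) (n : ℕ) :
    Measurable (M.currentState H n) := by
  cases n with
  | zero => exact measurable_const
  | succ n =>
    by_cases h : H ∣ n + 1
    · have e : M.currentState H (n + 1) = fun _ => M.start := by
        funext w; simp [EpisodicMDP.currentState, h]
      rw [e]; exact measurable_const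
    · have e : M.currentState H (n + 1) = fun w => Record.nextState (w (Fin.last n)) := by
        funext w; simp [EpisodicMDP.currentState, h]
      rw [e]; exact measurable_nextState.comp (measurable_pi_apply (Fin.last n))

/-- The information on which the algorithm bases its action at time step `n`. -/
def EpisodicMDP.info (M : EpisodicMDP S A) (G : Digraph (S × A)) (H n : ℕ)
    (w : Fin n → Record S A) : (Fin n → View S A) × S :=
  (fun i => view G (w i), M.currentState H n w)

theorem EpisodicMDP.measurable_info (M : EpisodicMDP S A) (G : Digraph (S × A)) (H n : ℕ) :
    Measurable (M.info G H n) :=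
  (measurable_pi_lambda _ fun i => (measurable_view G).comp (measurable_pi_apply i)).prodMk
    (M.measurable_currentState H n)

/-- Conditional law of the pair visited at time step `n`, given the earlier records. -/
def EpisodicMDP.visitKernel (M : EpisodicMDP S A) (G : Digraph (S × A)) (H : ℕ)
    (alg : Algorithm S A) (n : ℕ) : Kernel (Fin n → Record S A) (S × A) :=
  (Kernel.deterministic (M.currentState H n) (M.measurable_currentState H n)) ×ₖ
    ((alg.act n).comap (M.info G H n) (M.measurable_info G H n))

/-- Conditional law of the record of time step `n`, given the earlier records: the samples are drawn
afresh, independently of the past and of the action chosen now. -/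
def EpisodicMDP.stepKernel (M : EpisodicMDP S A) (G : Digraph (S × A)) (H : ℕ)
    (alg : Algorithm S A) (n : ℕ) : Kernel (Fin n → Record S A) (Record S A) :=
  (M.visitKernel G H alg n) ×ₖ (Kernel.const _ M.tableLaw)

/-- Joint law of the records of the first `n` time steps when `alg` interacts with `M` under the
feedback graph `G`. -/
def EpisodicMDP.law (M : EpisodicMDP S A) (G : Digraph (S × A)) (H : ℕ)
    (alg : Algorithm S A) : (n : ℕ) → Measure (Fin n → Record S A)
  | 0 => Measure.dirac Fin.elim0
  | n + 1 => (M.law G H alg n ⊗ₘ M.stepKernel G H alg n).map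
      fun p => (Fin.snoc p.1 p.2 : Fin (n + 1) → Record S A)

/-- `M.value π m h s` is the expected sum of the next `m` rewards when the deterministic
time-dependent policy `π` is followed from state `s` at time `h` of an episode on
(times are `0, …, H - 1`). -/
def EpisodicMDP.value (M : EpisodicMDP S A) (π : ℕ → S → A) : ℕ → ℕ → S → ℝ
  | 0, _, _ => 0
  | m + 1, h, s => ∫ r, r ∂(M.rew (s, π h s)) +
      ∫ s', M.value π m (h + 1) s' ∂(M.next (s, π h s))

/-- The optimal return of an episode of length `H` from the initial state. -/
def EpisodicMDP.optimalReturn (M : EpisodicMDP S A) (H : ℕ) : ℝ :=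
  ⨆ π : ℕ → S → A, M.value π H 0 M.start

/-- The expected regret of `alg` after `T` episodes of length `H`: the expected cumulative difference
between the optimal return and the return achieved. -/
def EpisodicMDP.expectedRegret (M : EpisodicMDP S A) (G : Digraph (S × A)) (H : ℕ)
    (alg : Algorithm S A) (T : ℕ) : ℝ :=
  T * M.optimalReturn H - ∫ w, ∑ i, (w i).reward ∂(M.law G H alg (T * H))

end Interaction

end FeedbackRL

end

/-! The hard instances hide a bandit problem with `K = α` arms, a maximum independent set `Z` of
`G₁`, behind a tree. The inner nodes of an `A`-ary tree are states of `G₂`, its `N` leaves are the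
states of `G₁`, and two further states of `G₂` are absorbing, one with reward one and one with
reward zero. At a leaf, an arm in `Z` leads to the good or the bad state according to a coin; any
other action leads to the bad state. Since the leaves lie at depth below about `log_A N`, at least
`H / 3` rewards depend on the coin.

In the reference instance one arm `y₀` has a fair coin and all others have bias `1/2 - ε`, with `ε`
of order `√(K / T)`. Information about the other coins is never free. States of `G₂` have no edges
into `G₁`. An arm in `Z` reveals no coin of `Z` but its own, by independence, and playing it instead
of `y₀` loses about `ε H`. A pair outside `Z` may reveal all the coins at once, but it forfeits the
whole value of the episode, and `(K - 1) ε ≤ 1/2`, which follows from `T ≥ K³ / √2`, makes this at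
least as expensive per coin. So regret in the reference instance bounds the total number of
observations (`le_expectedRegret_refBias`).

If that regret is small, some arm `y ≠ y₀` is observed at most of order `T / K` times. Raising its
bias to `1/2 + ε` costs relative entropy of order `ε²` per observation, hence a small constant in
total, so by the change of measure `Strategy.IsAdapted.exp_mean_le` the algorithm still plays `y` in
at most two thirds of the episodes when `y` is the best arm (`mean_armCount_altBias_le`). Each
remaining episode loses about `ε H` (`le_expectedRegret_altBias`).

Both regret bounds come from one potential satisfying the Bellman inequalities up to errors
(`mean_reward_le`, `potential_bellman`). All randomness of the environment consists of coins, so the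
law of the interaction is a finite sum (`law_eq`) and no measure theory is needed beyond it. -/

noncomputable section

namespace FeedbackRL

/-! ### Finite coin-driven decision processes -/

section CoinProcess

/-- The probability that a coin with bias `p` shows `b`. -/
def coin (p : ℝ) (b : Bool) : ℝ := if b then p else 1 - p

theorem coin_nonneg {p : ℝ} (hp : p ∈ Set.Icc (0 : ℝ) 1) (b : Bool) : 0 ≤ coin p b := by
  cases b <;> simp [coin, hp.1, hp.2]

theorem sum_coin (p : ℝ) : ∑ b, coin p b = 1 := by simp [coin]

theorem sum_coin_mul (p : ℝ) (f : Bool → ℝ) :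
    ∑ b, coin p b * f b = p * f true + (1 - p) * f false := by simp [coin]

variable {X : Type*} [Fintype X] [DecidableEq X]

/-- The probability of the outcome `b` of independent coins with biases `q`. -/
def coinsProb (q : X → ℝ) (b : X → Bool) : ℝ := ∏ y, coin (q y) (b y)

theorem coinsProb_nonneg {q : X → ℝ} (hq : ∀ y, q y ∈ Set.Icc (0 : ℝ) 1) (b : X → Bool) :
    0 ≤ coinsProb q b := Finset.prod_nonneg fun y _ => coin_nonneg (hq y) (b y)

theorem sum_coinsProb (q : X → ℝ) : ∑ b, coinsProb q b = 1 := by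
  simp only [coinsProb]
  rw [← Fintype.prod_sum fun y b => coin (q y) b]
  exact Finset.prod_eq_one fun y _ => sum_coin _

theorem sum_coinsProb_mul_apply (q : X → ℝ) (i : X) (h : Bool → ℝ) :
    ∑ b, coinsProb q b * h (b i) = ∑ b, coin (q i) b * h b := by
  have e : ∀ b : X → Bool, coinsProb q b * h (b i) =
      ∏ y, (coin (q y) (b y) * if y = i then h (b y) else 1) := fun b => by
    rw [Finset.prod_mul_distrib, Finset.prod_ite_eq' Finset.univ i fun y => h (b y)]
    simp [coinsProb]
  simp only [e]
  rw [← Fintype.prod_sum fun y b => coin (q y) b * if y = i then h b else 1]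
  rw [Finset.prod_eq_single i]
  · simp
  · intro y _ hy; simpa [hy] using sum_coin (q y)
  · simp

/-- The mean of a function that does not depend on the coin `i` does not depend on its bias. -/
theorem sum_coinsProb_mul_congr {q q' : X → ℝ} {i : X} (hq : ∀ y ≠ i, q' y = q y)
    {f : (X → Bool) → ℝ} (hf : ∀ b b' : X → Bool, (∀ y ≠ i, b y = b' y) → f b = f b') :
    ∑ b, coinsProb q' b * f b = ∑ b, coinsProb q b * f b := by
  -- Averaging over the flip of the coin `i` eliminates its bias: the two outcomes have total
  -- probability one and `f` does not distinguish them.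
  let flip : (X → Bool) → (X → Bool) := fun b => Function.update b i (!b i)
  have hflip : Function.Involutive flip := fun b => by
    funext y
    by_cases hy : y = i
    · subst hy; simp [flip]
    · simp [flip, hy]
  have split : ∀ r : X → ℝ, ∑ b, coinsProb r b * f b =
      (∑ b, (∏ y ∈ Finset.univ.erase i, coin (r y) (b y)) * f b) / 2 := fun r => by
    have e : ∑ b, coinsProb r (flip b) * f (flip b) = ∑ b, coinsProb r b * f b :=
      Equiv.sum_comp hflip.toPerm fun b => coinsProb r b * f b
    have : ∑ b, coinsProb r b * f b =
        (∑ b, (coinsProb r b * f b + coinsProb r (flip b) * f (flip b))) / 2 := by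
      rw [Finset.sum_add_distrib, e]; ring
    rw [this]
    congr 1
    refine Finset.sum_congr rfl fun b _ => ?_
    have h1 : f (flip b) = f b := hf _ _ fun y hy => by simp [flip, hy]
    have h2 : ∀ c : X → Bool, coinsProb r c =
        coin (r i) (c i) * ∏ y ∈ Finset.univ.erase i, coin (r y) (c y) := fun c =>
      (Finset.mul_prod_erase _ _ (Finset.mem_univ i)).symm
    have h3 : ∏ y ∈ Finset.univ.erase i, coin (r y) (flip b y) =
        ∏ y ∈ Finset.univ.erase i, coin (r y) (b y) :=
      Finset.prod_congr rfl fun y hy => by simp [flip, Finset.ne_of_mem_erase hy]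
    rw [h1, h2, h2 (flip b), h3]
    have h4 : coin (r i) (b i) + coin (r i) (flip b i) = 1 := by
      cases hb : b i <;> simp [flip, hb, coin]
    linear_combination (∏ y ∈ Finset.univ.erase i, coin (r y) (b y)) * f b * h4
  rw [split, split]
  congr 1
  refine Finset.sum_congr rfl fun b _ => ?_
  congr 1
  exact Finset.prod_congr rfl fun y hy => by rw [hq y (Finset.ne_of_mem_erase hy)]

/-- A trajectory of a process that visits a point of `X` in every step, together with the outcomes
of fresh coins for all points of `X`. -/
abbrev Traj (X : Type*) (n : ℕ) : Type _ := Fin n → X × (X → Bool)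

/-- A randomized rule for the point to visit next, given the trajectory so far. -/
structure Strategy (X : Type*) [Fintype X] where
  prob : (n : ℕ) → Traj X n → X → ℝ
  nonneg : ∀ n ω x, 0 ≤ prob n ω x
  sum_eq_one : ∀ n ω, ∑ x, prob n ω x = 1

namespace Strategy

variable (π : Strategy X) (q : X → ℝ)

/-- The mean over one step of the process after the trajectory `ω`. -/
def stepMean {n : ℕ} (ω : Traj X n) (f : X × (X → Bool) → ℝ) : ℝ :=
  ∑ x, π.prob n ω x * ∑ b, coinsProb q b * f (x, b)

/-- The probability of a trajectory. -/
def weight : (n : ℕ) → Traj X n → ℝ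
  | 0, _ => 1
  | n + 1, ω => weight n (Fin.init ω) *
      (π.prob n (Fin.init ω) (ω (Fin.last n)).1 * coinsProb q (ω (Fin.last n)).2)

/-- The mean of a function of the trajectory of length `n`. -/
def mean (n : ℕ) (f : Traj X n → ℝ) : ℝ := ∑ ω, π.weight q n ω * f ω

theorem sum_traj_succ {M : Type*} [AddCommMonoid M] (n : ℕ) (f : Traj X (n + 1) → M) :
    ∑ ω, f ω = ∑ ω : Traj X n, ∑ x, ∑ b, f (Fin.snoc ω (x, b)) := by
  rw [← (Fin.snocEquiv fun _ => X × (X → Bool)).sum_comp, Fintype.sum_prod_type, Finset.sum_comm]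
  refine Finset.sum_congr rfl fun ω _ => ?_
  rw [Fintype.sum_prod_type]
  rfl

theorem weight_snoc {n : ℕ} (ω : Traj X n) (u : X × (X → Bool)) :
    π.weight q (n + 1) (Fin.snoc ω u) =
      π.weight q n ω * (π.prob n ω u.1 * coinsProb q u.2) := by
  have : (Fin.init (Fin.snoc ω u : Traj X (n + 1)) : Traj X n) = ω :=
    Fin.init_snoc (α := fun _ => X × (X → Bool)) ..
  simp only [weight, this]
  simp

theorem mean_zero (f : Traj X 0 → ℝ) : π.mean q 0 f = f Fin.elim0 := by
  rw [mean, Fintype.sum_subsingleton _ Fin.elim0]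
  simp [weight]

theorem mean_succ (n : ℕ) (f : Traj X (n + 1) → ℝ) :
    π.mean q (n + 1) f =
      π.mean q n fun ω => π.stepMean q ω fun u => f (Fin.snoc ω u) := by
  simp only [mean, stepMean]
  rw [sum_traj_succ]
  refine Finset.sum_congr rfl fun ω _ => ?_
  simp only [weight_snoc, Finset.mul_sum]
  refine Finset.sum_congr rfl fun x _ => Finset.sum_congr rfl fun b _ => ?_
  ring

variable {q}

theorem weight_nonneg (hq : ∀ y, q y ∈ Set.Icc (0 : ℝ) 1) (n : ℕ) (ω : Traj X n) :
    0 ≤ π.weight q n ω := by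
  induction n with
  | zero => simp [weight]
  | succ n ih =>
    exact mul_nonneg (ih _) (mul_nonneg (π.nonneg _ _ _) (coinsProb_nonneg hq _))

theorem stepMean_add {n : ℕ} (ω : Traj X n) (f g : X × (X → Bool) → ℝ) :
    π.stepMean q ω (fun u => f u + g u) = π.stepMean q ω f + π.stepMean q ω g := by
  simp [stepMean, mul_add, Finset.sum_add_distrib]

theorem stepMean_fst {n : ℕ} (ω : Traj X n) (f : X → ℝ) :
    π.stepMean q ω (fun u => f u.1) = ∑ x, π.prob n ω x * f x := by
  simp [stepMean, ← Finset.sum_mul, sum_coinsProb]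

theorem stepMean_const {n : ℕ} (ω : Traj X n) (c : ℝ) : π.stepMean q ω (fun _ => c) = c := by
  rw [π.stepMean_fst ω fun _ => c, ← Finset.sum_mul, π.sum_eq_one, one_mul]

theorem mean_const (n : ℕ) (c : ℝ) : π.mean q n (fun _ => c) = c := by
  induction n with
  | zero => simp [mean_zero]
  | succ n ih => simp [mean_succ, stepMean_const, ih]

theorem mean_add (n : ℕ) (f g : Traj X n → ℝ) :
    π.mean q n (fun ω => f ω + g ω) = π.mean q n f + π.mean q n g := by
  simp [mean, mul_add, Finset.sum_add_distrib]

theorem mean_mul_left (n : ℕ) (c : ℝ) (f : Traj X n → ℝ) :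
    π.mean q n (fun ω => c * f ω) = c * π.mean q n f := by
  simp only [mean, Finset.mul_sum]
  exact Finset.sum_congr rfl fun ω _ => by ring

theorem mean_sub (n : ℕ) (f g : Traj X n → ℝ) :
    π.mean q n (fun ω => f ω - g ω) = π.mean q n f - π.mean q n g := by
  simp [mean, mul_sub, Finset.sum_sub_distrib]

theorem mean_sum {ι : Type*} (s : Finset ι) (n : ℕ) (f : ι → Traj X n → ℝ) :
    π.mean q n (fun ω => ∑ i ∈ s, f i ω) = ∑ i ∈ s, π.mean q n (f i) := by
  simp only [mean, Finset.mul_sum]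
  exact Finset.sum_comm

theorem mean_mono (hq : ∀ y, q y ∈ Set.Icc (0 : ℝ) 1) {n : ℕ} {f g : Traj X n → ℝ}
    (h : ∀ ω, f ω ≤ g ω) : π.mean q n f ≤ π.mean q n g :=
  Finset.sum_le_sum fun ω _ => mul_le_mul_of_nonneg_left (h ω) (π.weight_nonneg hq n ω)

end Strategy

end CoinProcess

/-! ### Change of measure for adapted strategies -/

section ChangeOfMeasure

variable {X : Type*} [Fintype X] [DecidableEq X]

/-- The relative entropy of a coin with bias `p` with respect to a coin with bias `p'`. -/
def coinEntropy (p p' : ℝ) : ℝ :=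
  p * Real.log (p / p') + (1 - p) * Real.log ((1 - p) / (1 - p'))

theorem exp_sum_le {ι : Type*} (s : Finset ι) {w f : ι → ℝ} (hw : ∀ i ∈ s, 0 ≤ w i)
    (h1 : ∑ i ∈ s, w i = 1) : Real.exp (∑ i ∈ s, w i * f i) ≤ ∑ i ∈ s, w i * Real.exp (f i) := by
  simpa using convexOn_exp.map_sum_le hw h1 fun i _ => Set.mem_univ (f i)

/-- A change of measure inequality for a change of the bias of a single coin. -/
theorem exp_sum_coinsProb_le {q q' : X → ℝ} {i : X} (hq : ∀ y, q y ∈ Set.Icc (0 : ℝ) 1)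
    (hne : ∀ y ≠ i, q' y = q y) (hi : q i ∈ Set.Ioo (0 : ℝ) 1) (hi' : q' i ∈ Set.Ioo (0 : ℝ) 1)
    (φ : (X → Bool) → ℝ) :
    Real.exp (∑ b, coinsProb q b * φ b - coinEntropy (q i) (q' i)) ≤
      ∑ b, coinsProb q' b * Real.exp (φ b) := by
  have pos : ∀ b, 0 < coin (q i) b := fun b => by
    cases b <;> simp [coin, hi.1, hi.2]
  have pos' : ∀ b, 0 < coin (q' i) b := fun b => by
    cases b <;> simp [coin, hi'.1, hi'.2]
  have hQ : ∀ b, coinsProb q' b = coinsProb q b * (coin (q' i) (b i) / coin (q i) (b i)) := by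
    intro b
    have h2 : ∀ r : X → ℝ, coinsProb r b =
        coin (r i) (b i) * ∏ y ∈ Finset.univ.erase i, coin (r y) (b y) := fun r =>
      (Finset.mul_prod_erase _ _ (Finset.mem_univ i)).symm
    have h3 : ∏ y ∈ Finset.univ.erase i, coin (q' y) (b y) =
        ∏ y ∈ Finset.univ.erase i, coin (q y) (b y) :=
      Finset.prod_congr rfl fun y hy => by rw [hne y (Finset.ne_of_mem_erase hy)]
    rw [h2, h2 q, h3]
    have := (pos (b i)).ne'
    field_simp
  -- The likelihood ratio is absorbed into the exponent; Jensen's inequality under `q` then gives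
  -- the variational bound for relative entropy.
  have hexp : ∀ b, coinsProb q' b * Real.exp (φ b) = coinsProb q b *
      Real.exp (φ b + Real.log (coin (q' i) (b i) / coin (q i) (b i))) := fun b => by
    rw [Real.exp_add, Real.exp_log (div_pos (pos' _) (pos _)), hQ]; ring
  have hlog : ∑ b, coinsProb q b * Real.log (coin (q' i) (b i) / coin (q i) (b i)) =
      - coinEntropy (q i) (q' i) := by
    rw [sum_coinsProb_mul_apply q i fun b => Real.log (coin (q' i) b / coin (q i) b),
      sum_coin_mul, coinEntropy]
    simp only [coin, if_true, Bool.false_eq_true, if_false]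
    rw [← inv_div (q i), ← inv_div (1 - q i), Real.log_inv, Real.log_inv]
    ring
  simp only [hexp]
  refine le_trans (le_of_eq ?_) (exp_sum_le _ (fun b _ => coinsProb_nonneg hq b) (sum_coinsProb q))
  congr 1
  simp only [mul_add, Finset.sum_add_distrib, hlog]
  ring

variable (obs : X → X → Prop)

/-- Two trajectories look the same if the same points are visited and the coins observed by these
visits show the same outcomes. -/
def ObsEq {n : ℕ} (ω ω' : Traj X n) : Prop :=
  ∀ t, (ω t).1 = (ω' t).1 ∧ ∀ y, obs (ω t).1 y → (ω t).2 y = (ω' t).2 y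

variable {obs}

theorem ObsEq.snoc {n : ℕ} {ω ω' : Traj X n} (h : ObsEq obs ω ω') {x : X} {b b' : X → Bool}
    (hb : ∀ y, obs x y → b y = b' y) :
    ObsEq obs (Fin.snoc ω (x, b) : Traj X (n + 1)) (Fin.snoc ω' (x, b')) := by
  intro t
  refine Fin.lastCases ?_ (fun t => ?_) t
  · simpa using hb
  · simpa using h t

theorem ObsEq.refl {n : ℕ} (ω : Traj X n) : ObsEq obs ω ω := fun _ => ⟨rfl, fun _ _ => rfl⟩

variable (obs) in
/-- A strategy is adapted if it uses only the observed coins. -/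
def Strategy.IsAdapted (π : Strategy X) : Prop :=
  ∀ n (ω ω' : Traj X n), ObsEq obs ω ω' → π.prob n ω = π.prob n ω'

open Classical in
/-- The number of steps in which the coin `i` is observed. -/
def obsCount (obs : X → X → Prop) (i : X) {n : ℕ} (ω : Traj X n) : ℝ :=
  ∑ t, if obs (ω t).1 i then 1 else 0

open Classical in
theorem obsCount_snoc (i : X) {n : ℕ} (ω : Traj X n) (u : X × (X → Bool)) :
    obsCount obs i (Fin.snoc ω u : Traj X (n + 1)) =
      obsCount obs i ω + if obs u.1 i then 1 else 0 := by
  rw [obsCount, Fin.sum_univ_castSucc]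
  simp only [Fin.snoc_castSucc, Fin.snoc_last, obsCount]

-- Jensen's inequality over the visited point reduces this to a fixed point `x`. If `x` reveals the
-- coin `i`, the entropy is paid; if not, `φ (x, ·)` ignores that coin, and its bias does not affect
-- the mean.
open Classical in
theorem Strategy.exp_stepMean_le (π : Strategy X) {q q' : X → ℝ} {i : X}
    (hq : ∀ y, q y ∈ Set.Icc (0 : ℝ) 1) (hne : ∀ y ≠ i, q' y = q y)
    (hi : q i ∈ Set.Ioo (0 : ℝ) 1) (hi' : q' i ∈ Set.Ioo (0 : ℝ) 1) {n : ℕ} (ω : Traj X n)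
    {φ : X × (X → Bool) → ℝ}
    (hφ : ∀ x b b', (∀ y, obs x y → b y = b' y) → φ (x, b) = φ (x, b')) :
    Real.exp (π.stepMean q ω fun u =>
        φ u - coinEntropy (q i) (q' i) * if obs u.1 i then 1 else 0) ≤
      π.stepMean q' ω fun u => Real.exp (φ u) := by
  refine (exp_sum_le _ (fun x _ => π.nonneg n ω x) (π.sum_eq_one n ω)).trans ?_
  refine Finset.sum_le_sum fun x _ => mul_le_mul_of_nonneg_left ?_ (π.nonneg n ω x)
  by_cases hx : obs x i
  · refine le_trans (le_of_eq ?_) (exp_sum_coinsProb_le hq hne hi hi' fun b => φ (x, b))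
    simp [hx, mul_sub, Finset.sum_sub_distrib, ← Finset.sum_mul, sum_coinsProb]
  · rw [sum_coinsProb_mul_congr (q := q) hne fun b b' hb => by
      simp only [hφ x b b' fun y hy => hb y fun e => hx (e ▸ hy)]]
    refine le_trans (le_of_eq ?_)
      (exp_sum_le _ (fun b _ => coinsProb_nonneg hq b) (sum_coinsProb q))
    simp [hx]

/-- The change of measure inequality for observable functions of the trajectory: changing the bias
of one coin costs its relative entropy for every observation of this coin. -/
theorem Strategy.IsAdapted.exp_mean_le {π : Strategy X} (hπ : π.IsAdapted obs) {q q' : X → ℝ}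
    {i : X} (hq : ∀ y, q y ∈ Set.Icc (0 : ℝ) 1)
    (hne : ∀ y ≠ i, q' y = q y)
    (hi : q i ∈ Set.Ioo (0 : ℝ) 1) (hi' : q' i ∈ Set.Ioo (0 : ℝ) 1) {n : ℕ} {g : Traj X n → ℝ}
    (hg : ∀ ω ω', ObsEq obs ω ω' → g ω = g ω') :
    Real.exp (π.mean q n g - coinEntropy (q i) (q' i) * π.mean q n (obsCount obs i)) ≤
      π.mean q' n fun ω => Real.exp (g ω) := by
  classical
  induction n with
  | zero => simp [mean_zero, obsCount]
  | succ n ih =>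
    let c := coinEntropy (q i) (q' i)
    -- The last step is integrated out under `q'`. The induction hypothesis applies to `log s`,
    -- which is again observable because the strategy is adapted.
    let s : Traj X n → ℝ := fun ω => π.stepMean q' ω fun u => Real.exp (g (Fin.snoc ω u))
    have step : ∀ ω : Traj X n, Real.exp (π.stepMean q ω fun u =>
        g (Fin.snoc ω u) - c * if obs u.1 i then 1 else 0) ≤ s ω := fun ω =>
      π.exp_stepMean_le hq hne hi hi' ω fun x b b' hb => hg _ _ ((ObsEq.refl ω).snoc hb)
    have spos : ∀ ω, 0 < s ω := fun ω => (Real.exp_pos _).trans_le (step ω)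
    have hs : ∀ ω ω', ObsEq obs ω ω' → Real.log (s ω) = Real.log (s ω') := by
      intro ω ω' h
      congr 1
      simp only [s, stepMean]
      rw [hπ n ω ω' h]
      refine Finset.sum_congr rfl fun x _ => ?_
      congr 1
      refine Finset.sum_congr rfl fun b _ => ?_
      rw [hg _ _ (h.snoc fun _ _ => rfl)]
    have key := ih hs
    simp only [Real.exp_log (spos _)] at key
    rw [mean_succ π q' n]
    refine le_trans (Real.exp_le_exp.2 ?_) key
    have hN : π.mean q (n + 1) (obsCount obs i) = π.mean q n (obsCount obs i) +
        π.mean q n fun ω => π.stepMean q ω fun u => if obs u.1 i then 1 else 0 := by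
      rw [mean_succ, ← mean_add]
      congr 1
      funext ω
      simp only [obsCount_snoc]
      rw [stepMean_add, stepMean_const]
    have hle : π.mean q n (fun ω => π.stepMean q ω (fun u => g (Fin.snoc ω u)) -
        c * π.stepMean q ω fun u => if obs u.1 i then 1 else 0) ≤
        π.mean q n fun ω => Real.log (s ω) := by
      refine mean_mono π hq fun ω => ?_
      refine le_trans (le_of_eq ?_) ((Real.le_log_iff_exp_le (spos ω)).2 (step ω))
      simp only [stepMean, mul_sub, Finset.sum_sub_distrib, Finset.mul_sum]
      congr 1
      exact Finset.sum_congr rfl fun x _ => Finset.sum_congr rfl fun b _ => by ring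
    rw [mean_sub, mean_mul_left] at hle
    rw [hN, mean_succ]
    linarith

end ChangeOfMeasure

/-! ### MDPs driven by coins, and the law of the interaction as a finite sum -/

section CoinMDP

/-- The law of a coin with bias `p`. -/
def coinMeasure (p : ℝ) : Measure Bool :=
  ENNReal.ofReal p • Measure.dirac true + ENNReal.ofReal (1 - p) • Measure.dirac false

theorem coinMeasure_singleton (p : ℝ) (b : Bool) :
    coinMeasure p {b} = ENNReal.ofReal (coin p b) := by
  cases b <;> simp [coinMeasure, coin]

theorem isProbabilityMeasure_coinMeasure {p : ℝ} (hp : p ∈ Set.Icc (0 : ℝ) 1) :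
    IsProbabilityMeasure (coinMeasure p) := by
  constructor
  have h : 0 ≤ 1 - p := by linarith [hp.2]
  simp [coinMeasure, ← ENNReal.ofReal_add hp.1 h]

theorem integral_coinMeasure {p : ℝ} (hp : p ∈ Set.Icc (0 : ℝ) 1) (f : Bool → ℝ) :
    ∫ b, f b ∂(coinMeasure p) = p * f true + (1 - p) * f false := by
  have := isProbabilityMeasure_coinMeasure hp
  rw [integral_fintype Integrable.of_finite]
  have h : ∀ b, (coinMeasure p).real {b} = coin p b := fun b => by
    rw [measureReal_def, coinMeasure_singleton, ENNReal.toReal_ofReal (coin_nonneg hp b)]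
  simp [h, coin]

/-- An episodic MDP with deterministic rewards in which the next state of every pair is determined
by the toss of a coin. The biases of the coins are a separate parameter. -/
structure CoinMDP (S A : Type*) where
  start : S
  reward : S × A → ℝ
  reward_mem : ∀ x, reward x ∈ Set.Icc (0 : ℝ) 1
  outcome : S × A → Bool → S

namespace CoinMDP

variable {S A : Type*} [Fintype S] [MeasurableSpace S] [DiscreteMeasurableSpace S]
  [Fintype A] [MeasurableSpace A] [DiscreteMeasurableSpace A] [DecidableEq S] [DecidableEq A]
  (D : CoinMDP S A) {q : S × A → ℝ} (hq : ∀ y, q y ∈ Set.Icc (0 : ℝ) 1)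

/-- The episodic MDP with coins of biases `q`. -/
def toMDP : EpisodicMDP S A where
  start := D.start
  next x := (coinMeasure (q x)).map (D.outcome x)
  rew x := Measure.dirac (D.reward x)
  next_prob x := by
    have := isProbabilityMeasure_coinMeasure (hq x)
    exact Measure.isProbabilityMeasure_map Measurable.of_discrete.aemeasurable
  rew_prob x := inferInstance
  rew_mem x := by
    exact (ae_dirac_iff (measurableSet_Icc : MeasurableSet (Set.Icc (0 : ℝ) 1))).2 (D.reward_mem x)

/-- The record of a time step with given visited pair and coin tosses. -/
def record (u : (S × A) × (S × A → Bool)) : Record S A :=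
  (u.1, fun y => (D.reward y, D.outcome y (u.2 y)))

/-- The state at time step `n` after a given trajectory. -/
def state (H : ℕ) : (n : ℕ) → Traj (S × A) n → S
  | 0, _ => D.start
  | n + 1, ω => if H ∣ n + 1 then D.start
      else D.outcome (ω (Fin.last n)).1 ((ω (Fin.last n)).2 (ω (Fin.last n)).1)

theorem currentState_record (H n : ℕ) (ω : Traj (S × A) n) :
    (D.toMDP hq).currentState H n (fun t => D.record (ω t)) = D.state H n ω := by
  cases n <;> rfl

/-- The strategy that the algorithm `alg` follows, on the level of coin tosses. -/
def strategy (G : Digraph (S × A)) (H : ℕ) (alg : Algorithm S A) : Strategy (S × A) where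
  prob n ω x := if x.1 = D.state H n ω then
    (alg.act n (fun t => view G (D.record (ω t)), D.state H n ω)).real {x.2} else 0
  nonneg n ω x := by split_ifs <;> simp
  sum_eq_one n ω := by
    have := alg.act_markov n
    rw [Fintype.sum_prod_type, Finset.sum_eq_single (D.state H n ω)]
    · simp
    · intro s _ hs; simp [hs]
    · simp

theorem strategy_isAdapted (G : Digraph (S × A)) (H : ℕ) (alg : Algorithm S A) :
    (D.strategy G H alg).IsAdapted fun x y => y = x ∨ G.Adj x y := by
  intro n ω ω' h
  have hv : (fun t => view G (D.record (ω t))) = fun t => view G (D.record (ω' t)) := by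
    funext t
    obtain ⟨h1, h2⟩ := h t
    refine Prod.ext h1 (funext fun y => ?_)
    by_cases hy : y = (ω t).1 ∨ G.Adj (ω t).1 y
    · refine (if_pos hy).trans (Eq.trans ?_ (if_pos (h1 ▸ hy)).symm)
      simp only [record, h2 y hy]
    · exact (if_neg hy).trans (if_neg (h1 ▸ hy)).symm
  have hs : D.state H n ω = D.state H n ω' := by
    cases n with
    | zero => rfl
    | succ n =>
      obtain ⟨h1, h2⟩ := h (Fin.last n)
      simp only [state]
      rw [h2 _ (Or.inl rfl), h1]
  funext x
  simp only [strategy, hv, hs]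

theorem lintegral_tableLaw {f : (S × A → ℝ × S) → ENNReal} (hf : Measurable f) :
    ∫⁻ τ, f τ ∂(D.toMDP hq).tableLaw =
      ∑ b, ENNReal.ofReal (coinsProb q b) * f fun y => (D.reward y, D.outcome y (b y)) := by
  have inst : ∀ x, IsProbabilityMeasure (coinMeasure (q x)) := fun x =>
    isProbabilityMeasure_coinMeasure (hq x)
  have hmeas : ∀ x : S × A, Measurable fun b : Bool => (D.reward x, D.outcome x b) := fun x =>
    Measurable.of_discrete
  have h1 : ∀ x, ((D.toMDP hq).rew x).prod ((D.toMDP hq).next x) =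
      (coinMeasure (q x)).map fun b => (D.reward x, D.outcome x b) := fun x => by
    simp only [toMDP]
    rw [Measure.dirac_prod, Measure.map_map (by fun_prop) Measurable.of_discrete]
    rfl
  have inst' : ∀ x, IsProbabilityMeasure
      ((coinMeasure (q x)).map fun b => (D.reward x, D.outcome x b)) := fun x =>
    Measure.isProbabilityMeasure_map (hmeas x).aemeasurable
  have h2 : (D.toMDP hq).tableLaw = (Measure.pi fun x => coinMeasure (q x)).map
      fun b x => (D.reward x, D.outcome x (b x)) := by
    rw [EpisodicMDP.tableLaw, Measure.pi_map_pi fun x => (hmeas x).aemeasurable]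
    simp only [h1]
  rw [h2, lintegral_map hf Measurable.of_discrete, lintegral_fintype]
  refine Finset.sum_congr rfl fun b _ => ?_
  rw [Measure.pi_singleton, mul_comm, coinsProb,
    ENNReal.ofReal_prod_of_nonneg fun y _ => coin_nonneg (hq y) _]
  simp only [coinMeasure_singleton]

theorem lintegral_stepKernel (G : Digraph (S × A)) (H : ℕ) (alg : Algorithm S A) {n : ℕ}
    (ω : Traj (S × A) n) {f : Record S A → ENNReal} (hf : Measurable f) :
    ∫⁻ u, f u ∂((D.toMDP hq).stepKernel G H alg n fun t => D.record (ω t)) =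
      ∑ x, ∑ b, ENNReal.ofReal ((D.strategy G H alg).prob n ω x * coinsProb q b) *
        f (D.record (x, b)) := by
  have := alg.act_markov n
  have inst : IsProbabilityMeasure (D.toMDP hq).tableLaw := by
    have h1 := (D.toMDP hq).rew_prob
    have h2 := (D.toMDP hq).next_prob
    rw [EpisodicMDP.tableLaw]; infer_instance
  have i2 : IsMarkovKernel ((D.toMDP hq).visitKernel G H alg n) := by
    rw [EpisodicMDP.visitKernel]; infer_instance
  rw [EpisodicMDP.stepKernel, Kernel.prod_apply, Kernel.const_apply,
    lintegral_prod _ hf.aemeasurable, lintegral_fintype]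
  refine Finset.sum_congr rfl fun x _ => ?_
  have hv : (D.toMDP hq).visitKernel G H alg n (fun t => D.record (ω t)) {x} =
      ENNReal.ofReal ((D.strategy G H alg).prob n ω x) := by
    have hx : ({x} : Set (S × A)) = {x.1} ×ˢ {x.2} := by simp
    rw [EpisodicMDP.visitKernel, Kernel.prod_apply, Kernel.deterministic_apply,
      Kernel.comap_apply, hx, Measure.prod_prod, EpisodicMDP.info, currentState_record, strategy]
    by_cases h : x.1 = D.state H n ω
    · simp [h]
    · simp [h, Ne.symm h]
  have hfx : Measurable fun τ => f (x, τ) := hf.comp measurable_prodMk_left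
  rw [hv, lintegral_tableLaw D hq hfx, mul_comm, Finset.mul_sum]
  refine Finset.sum_congr rfl fun b _ => ?_
  rw [ENNReal.ofReal_mul ((D.strategy G H alg).nonneg n ω x), mul_assoc]
  rfl

/-- The law of the records, as a finite sum over the trajectories of coin tosses. -/
theorem law_eq (G : Digraph (S × A)) (H : ℕ) (alg : Algorithm S A) (n : ℕ) :
    (D.toMDP hq).law G H alg n =
      ∑ ω : Traj (S × A) n, ENNReal.ofReal ((D.strategy G H alg).weight q n ω) •
        Measure.dirac fun t => D.record (ω t) := by
  induction n with
  | zero =>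
    rw [Fintype.sum_subsingleton _ Fin.elim0]
    simp only [EpisodicMDP.law, Strategy.weight, ENNReal.ofReal_one, one_smul]
    congr 1
    exact Subsingleton.elim _ _
  | succ n ih =>
    have := alg.act_markov n
    have inst : IsProbabilityMeasure (D.toMDP hq).tableLaw := by
      have h1 := (D.toMDP hq).rew_prob
      have h2 := (D.toMDP hq).next_prob
      rw [EpisodicMDP.tableLaw]; infer_instance
    have i2 : IsMarkovKernel ((D.toMDP hq).visitKernel G H alg n) := by
      rw [EpisodicMDP.visitKernel]; infer_instance
    have i3 : IsMarkovKernel ((D.toMDP hq).stepKernel G H alg n) := by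
      rw [EpisodicMDP.stepKernel]; infer_instance
    have i4 : IsFiniteMeasure ((D.toMDP hq).law G H alg n) := by
      rw [ih]
      constructor
      simp
    refine Measure.ext_of_lintegral _ fun f hf => ?_
    have hsnoc : Measurable fun p : (Fin n → Record S A) × Record S A =>
        (Fin.snoc p.1 p.2 : Fin (n + 1) → Record S A) := by
      refine measurable_pi_lambda _ fun t => ?_
      refine Fin.lastCases ?_ (fun t => ?_) t
      · simpa using measurable_snd
      · simpa using show Measurable fun c : (Fin n → Record S A) × Record S A => c.1 t from
          (measurable_pi_apply t).comp measurable_fst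
    have hfs : Measurable fun p : (Fin n → Record S A) × Record S A =>
        f (Fin.snoc p.1 p.2 : Fin (n + 1) → Record S A) := hf.comp hsnoc
    rw [EpisodicMDP.law, lintegral_map hf hsnoc, Measure.lintegral_compProd hfs, ih,
      lintegral_finsetSum_measure, lintegral_finsetSum_measure, Strategy.sum_traj_succ]
    refine Finset.sum_congr rfl fun ω _ => ?_
    have hfω : Measurable fun u : Record S A =>
        f (Fin.snoc (fun t => D.record (ω t)) u : Fin (n + 1) → Record S A) :=
      hfs.comp measurable_prodMk_left
    rw [lintegral_smul_measure, lintegral_dirac, lintegral_stepKernel D hq G H alg ω hfω, smul_eq_mul, Finset.mul_sum]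
    refine Finset.sum_congr rfl fun x _ => ?_
    rw [Finset.mul_sum]
    refine Finset.sum_congr rfl fun b _ => ?_
    rw [lintegral_smul_measure, lintegral_dirac' _ hf, Strategy.weight_snoc,
      ENNReal.ofReal_mul ((D.strategy G H alg).weight_nonneg hq n ω), smul_eq_mul, mul_assoc]
    congr 3
    funext t
    refine Fin.lastCases ?_ (fun t => ?_) t <;> simp

theorem integral_law (G : Digraph (S × A)) (H : ℕ) (alg : Algorithm S A) (n : ℕ)
    (f : (Fin n → Record S A) → ℝ) :
    ∫ w, f w ∂(D.toMDP hq).law G H alg n =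
      (D.strategy G H alg).mean q n fun ω => f fun t => D.record (ω t) := by
  rw [law_eq, integral_finsetSum_measure]
  · refine Finset.sum_congr rfl fun ω _ => ?_
    rw [integral_smul_measure, integral_dirac,
      ENNReal.toReal_ofReal ((D.strategy G H alg).weight_nonneg hq n ω), smul_eq_mul]
  · intro ω _
    refine Integrable.smul_measure ?_ ENNReal.ofReal_ne_top
    exact integrable_dirac (by simp)

theorem integral_reward (G : Digraph (S × A)) (H : ℕ) (alg : Algorithm S A) (n : ℕ) :
    ∫ w, ∑ i, (w i).reward ∂(D.toMDP hq).law G H alg n =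
      (D.strategy G H alg).mean q n fun ω => ∑ t, D.reward (ω t).1 := by
  rw [integral_law]
  rfl

end CoinMDP

end CoinMDP

/-! ### Bellman inequalities and values in coin-driven MDPs -/

namespace CoinMDP

variable {S A : Type*} [Fintype S] [MeasurableSpace S] [DiscreteMeasurableSpace S]
  [Fintype A] [MeasurableSpace A] [DiscreteMeasurableSpace A] [DecidableEq S] [DecidableEq A]
  (D : CoinMDP S A) {q : S × A → ℝ}

theorem stepMean_strategy_le (G : Digraph (S × A)) (H : ℕ) (alg : Algorithm S A) {n : ℕ}
    (ω : Traj (S × A) n) (f : (S × A) × (S × A → Bool) → ℝ) (c : ℝ)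
    (h : ∀ x : S × A, x.1 = D.state H n ω → ∑ b, coinsProb q b * f (x, b) ≤ c) :
    (D.strategy G H alg).stepMean q ω f ≤ c := by
  calc (D.strategy G H alg).stepMean q ω f ≤ ∑ x, (D.strategy G H alg).prob n ω x * c := by
        refine Finset.sum_le_sum fun x _ => ?_
        by_cases hx : x.1 = D.state H n ω
        · exact mul_le_mul_of_nonneg_left (h x hx) ((D.strategy G H alg).nonneg n ω x)
        · have : (D.strategy G H alg).prob n ω x = 0 := if_neg hx
          simp [this]
    _ = c := by rw [← Finset.sum_mul, (D.strategy G H alg).sum_eq_one, one_mul]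

/-- If `U` satisfies the Bellman inequalities up to the errors `k`, then it bounds the expected sum
of rewards, up to the expected sum of the errors. -/
theorem mean_reward_le (hq : ∀ y, q y ∈ Set.Icc (0 : ℝ) 1) (G : Digraph (S × A)) {H : ℕ} (hH : 0 < H) (alg : Algorithm S A)
    (U : ℕ → S → ℝ) (k : ℕ → S × A → ℝ) (hU : ∀ s, 0 ≤ U H s)
    (hB : ∀ h < H, ∀ x, D.reward x + (q x * U (h + 1) (D.outcome x true) +
      (1 - q x) * U (h + 1) (D.outcome x false)) ≤ U h x.1 + k h x) (T : ℕ) :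
    (D.strategy G H alg).mean q (T * H) (fun ω => ∑ t, D.reward (ω t).1) ≤ T * U 0 D.start +
      (D.strategy G H alg).mean q (T * H) fun ω => ∑ t : Fin (T * H), k (t % H) (ω t).1 := by
  set π := D.strategy G H alg
  -- Corrected rewards plus current potential form a supermartingale, except that each new episode
  -- adds `U 0 D.start`. The `+ 1` counts the episode in progress; at `n = T * H` it cancels against
  -- the potential of the fresh start state.
  have key : ∀ n, π.mean q n (fun ω => (∑ t : Fin n, (D.reward (ω t).1 - k (t % H) (ω t).1)) +
      U (n % H) (D.state H n ω)) ≤ ((n / H : ℕ) + 1) * U 0 D.start := by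
    intro n
    induction n with
    | zero => simp [Strategy.mean_zero, state]
    | succ n ih =>
      rw [Strategy.mean_succ]
      have hstep : ∀ ω : Traj (S × A) n,
          (π.stepMean q ω fun u => (∑ t : Fin (n + 1), (D.reward ((Fin.snoc ω u : Traj (S × A) (n + 1)) t).1 -
            k (t % H) ((Fin.snoc ω u : Traj (S × A) (n + 1)) t).1)) +
            U ((n + 1) % H) (D.state H (n + 1) (Fin.snoc ω u))) ≤
          ((∑ t : Fin n, (D.reward (ω t).1 - k (t % H) (ω t).1)) + U (n % H) (D.state H n ω)) +
            if H ∣ n + 1 then U 0 D.start else 0 := by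
        intro ω
        refine D.stepMean_strategy_le G H alg ω _ _ fun x hx => ?_
        have hx' := hB (n % H) (Nat.mod_lt _ hH) x
        have hU' : ∑ b, coinsProb q b * U ((n + 1) % H) (D.state H (n + 1)
            (Fin.snoc ω (x, b))) ≤ q x * U (n % H + 1) (D.outcome x true) +
              (1 - q x) * U (n % H + 1) (D.outcome x false) +
              if H ∣ n + 1 then U 0 D.start else 0 := by
          simp only [state, Fin.snoc_last]
          by_cases hd : H ∣ n + 1
          -- The last step of an episode: the potential at time `H` is dropped, being nonnegative,
          -- and the state is reset.
          · have hm : n % H + 1 = H := by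
              have h1 := Nat.mod_lt n hH
              have h2 : (n % H + 1) % H = 0 := by
                rw [Nat.mod_add_mod]; exact Nat.mod_eq_zero_of_dvd hd
              have h3 := Nat.dvd_of_mod_eq_zero h2
              exact le_antisymm h1 (Nat.le_of_dvd (Nat.succ_pos _) h3)
            simp only [hd, if_true, Nat.mod_eq_zero_of_dvd hd, hm]
            rw [← Finset.sum_mul, sum_coinsProb, one_mul]
            have := mul_nonneg (hq x).1 (hU (D.outcome x true))
            have := mul_nonneg (sub_nonneg.2 (hq x).2) (hU (D.outcome x false))
            linarith
          · have hm : (n + 1) % H = n % H + 1 := by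
              rw [Nat.add_mod_eq_ite]
              have h1 : 1 % H = 1 ∨ H = 1 := by
                rcases Nat.lt_or_ge 1 H with h | h
                · exact Or.inl (Nat.mod_eq_of_lt h)
                · exact Or.inr (by omega)
              rcases h1 with h1 | h1
              · rw [h1]
                split_ifs with h2
                · exfalso
                  have h3 := Nat.mod_lt n hH
                  have h4 : n % H + 1 = H := by omega
                  apply hd
                  apply Nat.dvd_of_mod_eq_zero
                  rw [← Nat.mod_add_mod, h4, Nat.mod_self]
                · rfl
              · exact absurd (by rw [h1]; exact one_dvd _) hd
            simp only [hd, if_false, hm, add_zero]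
            rw [sum_coinsProb_mul_apply q x fun b => U (n % H + 1) (D.outcome x b),
              sum_coin_mul]
        simp only [mul_add, Finset.sum_add_distrib, Fin.sum_univ_castSucc, Fin.snoc_castSucc,
          Fin.snoc_last, ← Finset.sum_mul, sum_coinsProb, one_mul, Fin.val_castSucc, Fin.val_last]
        rw [hx] at hx'
        linarith
      refine (Strategy.mean_mono π hq hstep).trans ?_
      rw [Strategy.mean_add, Strategy.mean_const]
      refine (add_le_add_left ih _).trans (le_of_eq ?_)
      rw [Nat.succ_div]
      split_ifs <;> push_cast <;> ring
  have h := key (T * H)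
  rw [Nat.mul_div_cancel _ hH, Nat.mul_mod_left, Strategy.mean_add] at h
  have hstate : ∀ m, H ∣ m → ∀ ω : Traj (S × A) m, D.state H m ω = D.start := by
    rintro (_ | m) hm ω
    · rfl
    · simp [state, hm]
  have h0 : (fun ω => U 0 (D.state H (T * H) ω)) = fun _ => U 0 D.start := by
    funext ω
    rw [hstate _ (Dvd.intro_left T rfl)]
  rw [h0, Strategy.mean_const] at h
  simp only [Finset.sum_sub_distrib] at h
  rw [Strategy.mean_sub] at h
  linarith

theorem value_succ (hq : ∀ y, q y ∈ Set.Icc (0 : ℝ) 1) (σ : ℕ → S → A) (m h : ℕ) (s : S) :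
    (D.toMDP hq).value σ (m + 1) h s = D.reward (s, σ h s) +
      (q (s, σ h s) * (D.toMDP hq).value σ m (h + 1) (D.outcome (s, σ h s) true) +
        (1 - q (s, σ h s)) * (D.toMDP hq).value σ m (h + 1) (D.outcome (s, σ h s) false)) := by
  rw [EpisodicMDP.value]
  simp only [toMDP, integral_dirac]
  rw [integral_map Measurable.of_discrete.aemeasurable
    Measurable.of_discrete.aestronglyMeasurable, integral_coinMeasure (hq _)]

/-- Provides the upper bound without which the real supremum in `optimalReturn` would carry no
information. -/
theorem value_le (hq : ∀ y, q y ∈ Set.Icc (0 : ℝ) 1) (σ : ℕ → S → A) (m h : ℕ) (s : S) : (D.toMDP hq).value σ m h s ≤ m := by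
  induction m generalizing h s with
  | zero => simp [EpisodicMDP.value]
  | succ m ih =>
    rw [value_succ]
    have h1 := mul_le_mul_of_nonneg_left (ih (h + 1) (D.outcome (s, σ h s) true))
      (hq (s, σ h s)).1
    have h2 := mul_le_mul_of_nonneg_left (ih (h + 1) (D.outcome (s, σ h s) false))
      (sub_nonneg.2 (hq (s, σ h s)).2)
    have h3 := (D.reward_mem (s, σ h s)).2
    push_cast
    linarith

theorem value_le_optimalReturn (hq : ∀ y, q y ∈ Set.Icc (0 : ℝ) 1) (σ : ℕ → S → A) (H : ℕ) :
    (D.toMDP hq).value σ H 0 D.start ≤ (D.toMDP hq).optimalReturn H := by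
  refine le_ciSup (f := fun σ : ℕ → S → A => (D.toMDP hq).value σ H 0 D.start) ⟨H, ?_⟩ σ
  rintro _ ⟨σ, rfl⟩
  exact D.value_le hq σ H 0 D.start

end CoinMDP

/-! ### Heap-ordered trees -/

/-- The depth of the node `k` of the infinite `A`-ary tree in which the children of `k` are
`A * k + 1, …, A * k + A`. -/
def heapDepth (A : ℕ) : ℕ → ℕ
  | 0 => 0
  | k + 1 => heapDepth A (k / A) + 1
decreasing_by exact Nat.lt_succ_of_le (Nat.div_le_self k A)

theorem heapDepth_zero (A : ℕ) : heapDepth A 0 = 0 := by rw [heapDepth]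

theorem heapDepth_succ (A k : ℕ) : heapDepth A (k + 1) = heapDepth A (k / A) + 1 := by
  rw [heapDepth]

theorem heapDepth_mono (A : ℕ) : Monotone (heapDepth A) := by
  intro m n
  induction n using Nat.strong_induction_on generalizing m with
  | _ n ih =>
    intro hmn
    rcases m with _ | m
    · simp [heapDepth_zero]
    · obtain ⟨n, rfl⟩ : ∃ l, n = l + 1 := ⟨n - 1, by omega⟩
      rw [heapDepth_succ, heapDepth_succ]
      exact Nat.succ_le_succ (ih _ (Nat.lt_succ_of_le (Nat.div_le_self n A))
        (Nat.div_le_div_right (Nat.le_of_succ_le_succ hmn)))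

/-- With `A = B + 1`, the first node at depth `d` is `(A ^ d - 1) / B`, and the bound is an equality
there. -/
theorem pow_heapDepth_le (B k : ℕ) : (B + 1) ^ heapDepth (B + 1) k ≤ B * k + 1 := by
  induction k using Nat.strong_induction_on with
  | _ k ih =>
    rcases k with _ | k
    · simp [heapDepth_zero]
    · rw [heapDepth_succ, pow_succ]
      have h1 := ih (k / (B + 1)) (Nat.lt_succ_of_le (Nat.div_le_self k _))
      have h2 : (B + 1) * (k / (B + 1)) ≤ k := Nat.mul_div_le k (B + 1)
      calc (B + 1) ^ heapDepth (B + 1) (k / (B + 1)) * (B + 1)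
          ≤ (B * (k / (B + 1)) + 1) * (B + 1) := Nat.mul_le_mul_right _ h1
        _ = B * ((B + 1) * (k / (B + 1))) + B + 1 := by ring
        _ ≤ B * k + B + 1 := by gcongr
        _ = B * (k + 1) + 1 := by ring

/-- A heap-ordered tree with inner nodes `0, …, inner - 1` and leaves `inner, …, inner + N - 1`, all
of whose leaves lie in the last two levels. After the visit of a leaf at least a third of the
horizon `H` remains. -/
structure LeafTree (A N H : ℕ) where
  inner : ℕ
  height : ℕ
  -- Keeps the indices `N - 1` and `N` of the second state space free for the absorbing states.
  inner_lt : inner < N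
  parent_lt : ∀ k, k + 1 < inner + N → k / A < inner
  depth_leaf : ∀ j < N, heapDepth A (inner + j) = height ∨ heapDepth A (inner + j) + 1 = height
  horizon_le : H + 3 * (height + 1) ≤ 3 * H
  horizon_pos : 0 < H

theorem nonempty_leafTree {A N H : ℕ} (hA : 2 ≤ A) (hN : 0 < N)
    (hH : 2 + 2 * Real.logb A N ≤ H) : Nonempty (LeafTree A N H) := by
  have hlog : 0 ≤ Real.logb A N :=
    Real.logb_nonneg (by exact_mod_cast hA) (by exact_mod_cast hN)
  have hH2 : 2 ≤ H := by
    have : (2 : ℝ) ≤ H := by linarith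
    exact_mod_cast this
  rcases Nat.lt_or_ge 1 N with hN1 | hN1
  · obtain ⟨B, rfl⟩ : ∃ B, A = B + 1 := ⟨A - 1, by omega⟩
    obtain ⟨M, rfl⟩ : ∃ M, N = M + 2 := ⟨N - 2, by omega⟩
    set J := M / B with hJ
    have hB : 0 < B := by omega
    have hJ1 : B * J ≤ M := Nat.mul_div_le M B
    have hJ2 : M < B * J + B := by
      have := Nat.lt_mul_div_succ M hB
      rwa [mul_add, mul_one] at this
    have hJM : J ≤ M := Nat.div_le_self M B
    set D := heapDepth (B + 1) J with hD
    have hpow : (B + 1) ^ D < M + 2 := by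
      have := pow_heapDepth_le B J
      rw [← hD] at this
      omega
    have hDlog : (D : ℝ) < Real.logb (B + 1 : ℕ) (M + 2 : ℕ) := by
      rw [Real.lt_logb_iff_rpow_lt (by exact_mod_cast hA) (by positivity), Real.rpow_natCast]
      exact_mod_cast hpow
    have hHD : 2 + 2 * D < H := by
      have : (2 : ℝ) + 2 * D < H := by linarith
      exact_mod_cast this
    -- `J + 1` is `(N - 1) / (A - 1)` rounded up, the least number of inner nodes that can carry `N`
    -- leaves. All leaves come after the last inner node `J`, of depth `D`, and have parents at most
    -- `J`, so their depths are `D` or `D + 1`.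
    refine ⟨⟨J + 1, D + 1, by omega, fun k hk => ?_, fun j hj => ?_, by omega, by omega⟩⟩
    · rw [Nat.div_lt_iff_lt_mul (by omega)]
      have : (J + 1) * (B + 1) = B * J + B + J + 1 := by ring
      omega
    · have h1 : D ≤ heapDepth (B + 1) (J + 1 + j) := heapDepth_mono _ (by omega)
      have h2 : heapDepth (B + 1) (J + 1 + j) ≤ D + 1 := by
        rw [show J + 1 + j = (J + j) + 1 by ring, heapDepth_succ]
        refine Nat.succ_le_succ (heapDepth_mono _ ?_)
        rw [← Nat.lt_succ_iff, Nat.div_lt_iff_lt_mul (by omega)]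
        have : (J + 1) * (B + 1) = B * J + B + J + 1 := by ring
        have : J.succ = J + 1 := rfl
        rw [this]
        omega
      omega
  · obtain rfl : N = 1 := by omega
    refine ⟨⟨0, 0, by omega, fun k hk => by omega, fun j hj => ?_, by omega, by omega⟩⟩
    obtain rfl : j = 0 := by omega
    simp [heapDepth_zero]

/-! ### The hard instances and their potential -/

namespace LeafTree

variable {A N H : ℕ} (t : LeafTree A N H)

/-- The absorbing state with reward one. -/
def good (N : ℕ) : Fin N ⊕ Fin (N + 1) := Sum.inr (Fin.last N)

/-- The absorbing state with reward zero. -/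
def bad (N : ℕ) : Fin N ⊕ Fin (N + 1) := Sum.inr ⟨N - 1, by omega⟩

/-- The state at the node `k` of the tree. -/
def node (k : ℕ) : Fin N ⊕ Fin (N + 1) :=
  if h : k < t.inner then Sum.inr ⟨k, by have := t.inner_lt; omega⟩
  else if h' : k < t.inner + N then Sum.inl ⟨k - t.inner, by omega⟩
  -- Children with an index beyond the last leaf are identified with the bad state.
  else bad N

theorem node_leaf (j : Fin N) : t.node (t.inner + j) = Sum.inl j := by
  simp [node]

theorem node_inner {k : ℕ} (h : k < t.inner) :
    t.node k = Sum.inr ⟨k, by have := t.inner_lt; omega⟩ := by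
  simp [node, h]

/-- The number of rewards that are at stake at a leaf: `H - height - 1` or `H - height`. -/
def stake (j : Fin N) : ℝ := (H : ℝ) - heapDepth A (t.inner + j) - 1

/-- The hard episodic MDP: the agent moves down the tree to a leaf, and the arms in `Z` lead to the
good or the bad state according to a coin. The shallow leaves have no reward, to make up for the
additional time step. -/
def hardMDP (Z : Finset (Fin N × Fin A)) : CoinMDP (Fin N ⊕ Fin (N + 1)) (Fin A) where
  start := t.node 0
  reward x := match x.1 with
    | Sum.inl j => if (j, x.2) ∈ Z ∧ heapDepth A (t.inner + j) = t.height then 1 / 2 else 0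
    | Sum.inr k => if (k : ℕ) = N then 1 else 0
  reward_mem x := by
    rcases x with ⟨j | k, a⟩
    · dsimp only; split_ifs <;> constructor <;> norm_num
    · dsimp only; split_ifs <;> constructor <;> norm_num
  outcome x b := match x.1 with
    | Sum.inl j => if (j, x.2) ∈ Z ∧ b = true then good N else bad N
    | Sum.inr k => if (k : ℕ) = N then good N
        else if (k : ℕ) < t.inner then t.node (A * k + x.2 + 1) else bad N

/-- The value of an arm with a fair coin. -/
def baseValue : ℝ := ((H : ℝ) - t.height) / 2

/-- An upper bound on the future rewards: the base value at the nodes of the tree, if they are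
reached at the time given by their depth. They are never reached at another time. -/
def potential (h : ℕ) (s : Fin N ⊕ Fin (N + 1)) : ℝ := match s with
  | Sum.inl j => if h = heapDepth A (t.inner + j) then t.baseValue
      else (1 + t.baseValue) * ((H : ℝ) - h)
  | Sum.inr k => if (k : ℕ) = N then (H : ℝ) - h
      else if (k : ℕ) < t.inner then
        if h = heapDepth A k then t.baseValue else (1 + t.baseValue) * ((H : ℝ) - h)
      else 0

theorem height_lt : (t.height : ℝ) + 1 + H / 3 ≤ H := by
  have h : ((H + 3 * (t.height + 1) : ℕ) : ℝ) ≤ (3 * H : ℕ) := by exact_mod_cast t.horizon_le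
  push_cast at h
  linarith

theorem horizon_cast_pos (t : LeafTree A N H) : (0 : ℝ) < H := by exact_mod_cast t.horizon_pos

theorem baseValue_pos : 0 < t.baseValue := by
  have h1 := t.height_lt
  have h2 := t.horizon_cast_pos
  rw [baseValue]
  linarith

theorem potential_good (h : ℕ) : t.potential h (good N) = (H : ℝ) - h := by
  simp [potential, good]

theorem potential_bad (h : ℕ) : t.potential h (bad N) = 0 := by
  have := t.inner_lt
  have h1 : N - 1 ≠ N := by omega
  have h2 : ¬ N - 1 < t.inner := by omega
  simp [potential, bad, h1, h2]

theorem potential_node {k : ℕ} (hk : k < t.inner + N) (h : ℕ) : t.potential h (t.node k) =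
    if h = heapDepth A k then t.baseValue else (1 + t.baseValue) * ((H : ℝ) - h) := by
  have := t.inner_lt
  by_cases hk' : k < t.inner
  · have h1 : k ≠ N := by omega
    simp [node, potential, hk', h1]
  · have h1 : t.inner + (k - t.inner) = k := by omega
    simp [node, potential, hk', hk, h1]

theorem potential_node_of_le {k : ℕ} (hk : t.inner + N ≤ k) (h : ℕ) :
    t.potential h (t.node k) = 0 := by
  have h1 : ¬ k < t.inner := by omega
  have h2 : ¬ k < t.inner + N := by omega
  simp only [node, h1, h2, dif_neg, not_false_eq_true]
  exact t.potential_bad h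

theorem potential_horizon_nonneg (s : Fin N ⊕ Fin (N + 1)) : 0 ≤ t.potential H s := by
  have := t.baseValue_pos
  rcases s with j | k <;> simp only [potential] <;> split_ifs <;> simp [this.le]

theorem potential_start : t.potential 0 (t.node 0) = t.baseValue := by
  rw [t.potential_node (by have := t.inner_lt; omega)]
  simp [heapDepth_zero]

theorem heapDepth_child (k : ℕ) (a : Fin A) :
    heapDepth A (A * k + a + 1) = heapDepth A k + 1 := by
  rw [heapDepth_succ, Nat.mul_add_div a.pos, Nat.div_eq_of_lt a.2, add_zero]

/-- The Bellman inequalities for the potential. -/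
theorem potential_bellman (Z : Finset (Fin N × Fin A))
    {q : (Fin N ⊕ Fin (N + 1)) × Fin A → ℝ} (hq : ∀ y, q y ∈ Set.Icc (0 : ℝ) 1)
    {κ : ℕ → (Fin N ⊕ Fin (N + 1)) × Fin A → ℝ} (hinr : ∀ h k a, 0 ≤ κ h (Sum.inr k, a))
    (hinl : ∀ h j a, - t.baseValue ≤ κ h (Sum.inl j, a))
    (harm : ∀ j a, (j, a) ∈ Z → t.stake j * (q (Sum.inl j, a) - 1 / 2) ≤
      κ (heapDepth A (t.inner + j)) (Sum.inl j, a)) {h : ℕ} (hh : h < H)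
    (x : (Fin N ⊕ Fin (N + 1)) × Fin A) :
    (t.hardMDP Z).reward x + (q x * t.potential (h + 1) ((t.hardMDP Z).outcome x true) +
      (1 - q x) * t.potential (h + 1) ((t.hardMDP Z).outcome x false)) ≤
        t.potential h x.1 + κ h x := by
  have hW := t.baseValue_pos
  have hh' : (h : ℝ) + 1 ≤ H := by exact_mod_cast hh
  rcases x with ⟨j | k, a⟩
  · have hrew : (t.hardMDP Z).reward (Sum.inl j, a) ≤ 1 := ((t.hardMDP Z).reward_mem _).2
    have hq1 := hq (Sum.inl j, a)
    have hκ := hinl h j a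
    by_cases hd : h = heapDepth A (t.inner + j)
    · by_cases hZ : (j, a) ∈ Z
      · have hκ' := harm j a hZ
        rw [← hd] at hκ'
        have hp : t.potential h (Sum.inl j) = t.baseValue := by simp [potential, hd]
        have h1 : (t.hardMDP Z).outcome (Sum.inl j, a) true = good N := by simp [hardMDP, hZ]
        have h2 : (t.hardMDP Z).outcome (Sum.inl j, a) false = bad N := by simp [hardMDP]
        dsimp only
        rw [h1, h2, potential_good, potential_bad, hp]
        refine le_trans (le_of_eq ?_) (add_le_add_right hκ' _)
        -- A fair coin is worth `1/2 + stake / 2` at a deep leaf and `stake / 2` at a shallow one;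
        -- both equal `baseValue`.
        rcases t.depth_leaf j j.2 with he | he
        · have : (t.hardMDP Z).reward (Sum.inl j, a) = 1 / 2 := by simp [hardMDP, hZ, he]
          rw [this, stake, baseValue, hd, he]
          push_cast
          ring
        · have h3 : heapDepth A (t.inner + j) ≠ t.height := by omega
          have : (t.hardMDP Z).reward (Sum.inl j, a) = 0 := by simp [hardMDP, h3]
          rw [this, stake, baseValue, hd, ← he]
          push_cast
          ring
      -- Outside `Z` the potential falls from `baseValue` to zero without reward, which leaves
      -- exactly the room for an error of `-baseValue`.
      · have hp : t.potential h (Sum.inl j) = t.baseValue := by simp [potential, hd]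
        have h1 : ∀ b, (t.hardMDP Z).outcome (Sum.inl j, a) b = bad N := by simp [hardMDP, hZ]
        have h2 : (t.hardMDP Z).reward (Sum.inl j, a) = 0 := by simp [hardMDP, hZ]
        dsimp only
        rw [h1, h1, potential_bad, hp, h2]
        linarith
    -- At a wrong time the potential exceeds the possible rewards `H - h` by at least `baseValue`,
    -- because `h < H`.
    · have hp : t.potential h (Sum.inl j) = (1 + t.baseValue) * ((H : ℝ) - h) := by
        simp [potential, hd]
      have hle : ∀ b, t.potential (h + 1) ((t.hardMDP Z).outcome (Sum.inl j, a) b) ≤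
          (H : ℝ) - h - 1 := by
        intro b
        by_cases hb : (j, a) ∈ Z ∧ b = true
        · simp only [hardMDP, hb, and_self, if_true, potential_good]
          push_cast
          linarith
        · have : (t.hardMDP Z).outcome (Sum.inl j, a) b = bad N := by
            simp only [hardMDP, hb, if_false]
          rw [this, potential_bad]
          linarith
      dsimp only
      rw [hp]
      have h1 := mul_le_mul_of_nonneg_left (hle true) hq1.1
      have h2 := mul_le_mul_of_nonneg_left (hle false) (sub_nonneg.2 hq1.2)
      have h3 : t.baseValue * 1 ≤ t.baseValue * ((H : ℝ) - h) :=
        mul_le_mul_of_nonneg_left (by linarith) hW.le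
      linarith
  · have hκ := hinr h k a
    suffices ∃ v, (∀ b, t.potential (h + 1) ((t.hardMDP Z).outcome (Sum.inr k, a) b) = v) ∧
        (t.hardMDP Z).reward (Sum.inr k, a) + v ≤ t.potential h (Sum.inr k) by
      obtain ⟨v, hv, hv'⟩ := this
      dsimp only
      rw [hv, hv]
      linarith
    by_cases hkN : (k : ℕ) = N
    · refine ⟨(H : ℝ) - h - 1, fun b => ?_, ?_⟩
      · simp only [hardMDP, hkN, if_true, potential_good]
        push_cast
        ring
      · simp [hardMDP, hkN, potential]
    · by_cases hkI : (k : ℕ) < t.inner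
      · refine ⟨t.potential (h + 1) (t.node (A * k + a + 1)), fun b => ?_, ?_⟩
        · simp only [hardMDP, hkN, hkI, if_true, if_false]
        · have hr : (t.hardMDP Z).reward (Sum.inr k, a) = 0 := by simp [hardMDP, hkN]
          have hpk : t.potential h (Sum.inr k) = if h = heapDepth A k then t.baseValue else
              (1 + t.baseValue) * ((H : ℝ) - h) := by simp [potential, hkN, hkI]
          rw [hr, hpk, zero_add]
          have h3 : 0 ≤ (1 + t.baseValue) * ((H : ℝ) - h - 1) :=
            mul_nonneg (by linarith) (by linarith)
          rcases Nat.lt_or_ge (A * k + a + 1) (t.inner + N) with hlt | hge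
          · rw [t.potential_node hlt, heapDepth_child]
            by_cases hd : h = heapDepth A k
            · simp [hd]
            · simp only [hd, add_left_inj, if_false]
              push_cast
              linarith
          · rw [t.potential_node_of_le hge]
            split_ifs <;> linarith
      · refine ⟨0, fun b => ?_, ?_⟩
        · simp only [hardMDP, hkN, hkI, if_false, potential_bad]
        · simp [hardMDP, hkN, hkI, potential]

section Value

variable (Z : Finset (Fin N × Fin A)) {q : (Fin N ⊕ Fin (N + 1)) × Fin A → ℝ}

theorem value_good (hq : ∀ y, q y ∈ Set.Icc (0 : ℝ) 1) (σ : ℕ → Fin N ⊕ Fin (N + 1) → Fin A)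
    (m h : ℕ) : ((t.hardMDP Z).toMDP hq).value σ m h (good N) = m := by
  induction m generalizing h with
  | zero => simp [EpisodicMDP.value]
  | succ m ih =>
    have h1 : ∀ a b, (t.hardMDP Z).outcome (good N, a) b = good N := by simp [hardMDP, good]
    have h2 : ∀ a, (t.hardMDP Z).reward (good N, a) = 1 := by simp [hardMDP, good]
    rw [CoinMDP.value_succ, h1, h1, h2, ih]
    push_cast
    ring

theorem value_bad (hq : ∀ y, q y ∈ Set.Icc (0 : ℝ) 1) (σ : ℕ → Fin N ⊕ Fin (N + 1) → Fin A)
    (m h : ℕ) : ((t.hardMDP Z).toMDP hq).value σ m h (bad N) = 0 := by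
  induction m generalizing h with
  | zero => simp [EpisodicMDP.value]
  | succ m ih =>
    have := t.inner_lt
    have e1 : N - 1 ≠ N := by omega
    have e2 : ¬ N - 1 < t.inner := by omega
    have h1 : ∀ a b, (t.hardMDP Z).outcome (bad N, a) b = bad N := by
      intro a b
      simp only [hardMDP, bad, e1, e2, if_false]
    have h2 : ∀ a, (t.hardMDP Z).reward (bad N, a) = 0 := by simp [hardMDP, bad, e1]
    rw [CoinMDP.value_succ, h1, h1, h2, ih]
    ring

/-- Every node of the tree can be reached by a fixed sequence of actions. -/
theorem exists_value_eq_value_node [NeZero A] (hq : ∀ y, q y ∈ Set.Icc (0 : ℝ) 1) (k : ℕ)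
    (hk : k < t.inner + N) :
    ∃ a : ℕ → Fin A, ∀ σ : ℕ → Fin N ⊕ Fin (N + 1) → Fin A,
      (∀ h < heapDepth A k, ∀ s, σ h s = a h) → ∀ m,
        ((t.hardMDP Z).toMDP hq).value σ (m + heapDepth A k) 0 (t.node 0) =
          ((t.hardMDP Z).toMDP hq).value σ m (heapDepth A k) (t.node k) := by
  induction k using Nat.strong_induction_on with
  | _ k ih =>
    rcases k with _ | k
    · exact ⟨fun _ => 0, fun σ _ m => by simp [heapDepth_zero]⟩
    · have hp := t.parent_lt k hk
      obtain ⟨a, ha⟩ := ih (k / A) (Nat.lt_succ_of_le (Nat.div_le_self k A)) (by omega)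
      have hA : 0 < A := Nat.pos_of_ne_zero (NeZero.ne A)
      let c : Fin A := ⟨k % A, Nat.mod_lt k hA⟩
      -- The parent of `k + 1` is `k / A`, and the action `k % A` leads from there to `k + 1`.
      refine ⟨Function.update a (heapDepth A (k / A)) c, fun σ hσ m => ?_⟩
      rw [heapDepth_succ] at hσ ⊢
      rw [show m + (heapDepth A (k / A) + 1) = (m + 1) + heapDepth A (k / A) by ring, ha σ]
      · have hc : σ (heapDepth A (k / A)) (t.node (k / A)) = c := by
          rw [hσ _ (Nat.lt_succ_self _)]
          simp
        have hI := t.inner_lt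
        have hN : k / A ≠ N := by omega
        rw [CoinMDP.value_succ, hc]
        have h1 : ∀ b, (t.hardMDP Z).outcome (t.node (k / A), c) b = t.node (k + 1) := by
          intro b
          rw [t.node_inner hp]
          simp only [hardMDP, hN, hp, if_false, if_true, c, Nat.div_add_mod]
        have h2 : (t.hardMDP Z).reward (t.node (k / A), c) = 0 := by
          rw [t.node_inner hp]
          simp [hardMDP, hN]
        rw [h1, h1, h2]
        ring
      · intro h hh s
        rw [hσ h (by omega)]
        simp [hh.ne]

/-- Attained by the policy that walks to the leaf `j` and plays `a` there. -/
theorem baseValue_add_le_optimalReturn (hq : ∀ y, q y ∈ Set.Icc (0 : ℝ) 1) {j : Fin N}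
    {a : Fin A} (hZ : (j, a) ∈ Z) : t.baseValue + t.stake j * (q (Sum.inl j, a) - 1 / 2) ≤
      ((t.hardMDP Z).toMDP hq).optimalReturn H := by
  have : NeZero A := ⟨a.pos.ne'⟩
  set e := heapDepth A (t.inner + j) with he
  obtain ⟨α, hα⟩ := t.exists_value_eq_value_node Z hq (t.inner + j) (by omega)
  let σ : ℕ → Fin N ⊕ Fin (N + 1) → Fin A := fun h _ => if h < e then α h else a
  have heH : e + 1 ≤ H := by
    have h1 := t.depth_leaf j j.2
    have h2 := t.horizon_le
    omega
  obtain ⟨m, hm⟩ : ∃ m, H = m + 1 + e := ⟨H - (e + 1), by omega⟩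
  have key := hα σ (fun h hh s => if_pos hh) (m + 1)
  refine le_trans (le_of_eq ?_) ((t.hardMDP Z).value_le_optimalReturn hq σ H)
  have hstart : (t.hardMDP Z).start = t.node 0 := rfl
  have hm' : (H : ℝ) = m + 1 + e := by exact_mod_cast hm
  have hσ : σ e (Sum.inl j) = a := if_neg (lt_irrefl e)
  have hv : ((t.hardMDP Z).toMDP hq).value σ H 0 (t.node 0) =
      ((t.hardMDP Z).toMDP hq).value σ (m + 1) e (Sum.inl j) := by
    rw [← t.node_leaf j, ← key, ← hm]
  have h1 : (t.hardMDP Z).outcome (Sum.inl j, a) true = good N := by simp [hardMDP, hZ]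
  have h2 : (t.hardMDP Z).outcome (Sum.inl j, a) false = bad N := by simp [hardMDP]
  rw [hstart, hv, CoinMDP.value_succ, hσ, h1, h2, value_good, value_bad]
  rcases t.depth_leaf j j.2 with hd | hd
  · have : (t.hardMDP Z).reward (Sum.inl j, a) = 1 / 2 := by simp [hardMDP, hZ, hd]
    rw [this, stake, baseValue, ← hd, ← he, hm']
    ring
  · have h3 : heapDepth A (t.inner + j) ≠ t.height := by omega
    have : (t.hardMDP Z).reward (Sum.inl j, a) = 0 := by simp [hardMDP, h3]
    rw [this, stake, baseValue, ← hd, ← he, hm']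
    push_cast
    ring

end Value

end LeafTree

/-! ### Numerical estimates -/

/-- The gap between the arms: `2/5 * √((K - 1) / T)`. -/
def armGap (K T : ℝ) : ℝ := 2 / 5 * √((K - 1) / T)

section ArmGap

variable {K T : ℝ}

theorem cube_le_of_div_sqrt_two_le (h0 : 0 < T) (hT : K ^ 3 / √2 ≤ T) :
    K ^ 3 ≤ 1.41422 * T := by
  have h2 : √2 ≤ 1.41422 := by
    rw [Real.sqrt_le_left (by norm_num)]; norm_num
  rw [div_le_iff₀ (by positivity)] at hT
  nlinarith

theorem armGap_pos (hK : 2 ≤ K) (hT : 0 < T) : 0 < armGap K T := by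
  have : 0 < (K - 1) / T := div_pos (by linarith) hT
  rw [armGap]
  positivity

theorem armGap_sq_mul (hK : 2 ≤ K) (hT : 0 < T) : armGap K T ^ 2 * T = 4 / 25 * (K - 1) := by
  have : 0 ≤ (K - 1) / T := div_nonneg (by linarith) hT.le
  rw [armGap, mul_pow, Real.sq_sqrt this]
  field_simp
  ring

/-- `8 * (K - 1) ≤ K ^ 3` is tight at `K = 2`, which is therefore the worst case. -/
theorem armGap_le (hK : 2 ≤ K) (hT : 0 < T) (h : K ^ 3 ≤ 1.41422 * T) :
    armGap K T ≤ 0.1683 := by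
  have h1 := armGap_sq_mul hK hT
  have h2 := (armGap_pos hK hT).le
  refine abs_le_of_sq_le_sq' ?_ (by norm_num) |>.2
  have h3 : 8 * (K - 1) ≤ K ^ 3 := by nlinarith [mul_nonneg (sub_nonneg.2 hK) (sub_nonneg.2 hK)]
  have h4 : armGap K T ^ 2 * T ≤ 0.1683 ^ 2 * T := by rw [h1]; linarith
  exact le_of_mul_le_mul_right h4 hT

/-- This is what the cubic growth of `T` is for: revealing all `K - 1` coins by one wasted episode
is no cheaper per coin than playing the arms. -/
theorem mul_armGap_le (hK : 2 ≤ K) (hT : 0 < T) (h : K ^ 3 ≤ 1.41422 * T) :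
    (K - 1) * armGap K T ≤ 1 / 2 := by
  have h1 := armGap_sq_mul hK hT
  refine abs_le_of_sq_le_sq' ?_ (by norm_num) |>.2
  have h3 : (K - 1) ^ 3 ≤ K ^ 3 := pow_le_pow_left₀ (by linarith) (by linarith) 3
  have h4 : ((K - 1) * armGap K T) ^ 2 * T ≤ (1 / 2) ^ 2 * T := by
    rw [mul_pow, mul_assoc, h1]; nlinarith
  exact le_of_mul_le_mul_right h4 hT

/-- Uses `K ≤ 2 * (K - 1)`; the constant is `5 / √2` rounded up. -/
theorem sqrt_mul_le_armGap (hK : 2 ≤ K) (hT : 0 < T) :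
    √(K * T) ≤ 3.536 * (armGap K T * T) := by
  have h1 := armGap_sq_mul hK hT
  have h2 := (armGap_pos hK hT).le
  rw [Real.sqrt_le_left (by positivity)]
  have : (3.536 * (armGap K T * T)) ^ 2 = 3.536 ^ 2 * (armGap K T ^ 2 * T) * T := by ring
  rw [this, h1]
  nlinarith

end ArmGap

/-- The entropy equals `2 * ε * log ((1 + 2 * ε) / (1 - 2 * ε))`, and the logarithm is bounded
linearly on the range of `ε`. -/
theorem coinEntropy_half_le {ε : ℝ} (h0 : 0 < ε) (h1 : ε ≤ 0.1683) :
    coinEntropy (1 / 2 - ε) (1 / 2 + ε) ≤ 10.04 * ε ^ 2 := by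
  have e1 : (1 - (1 / 2 - ε)) / (1 - (1 / 2 + ε)) = (1 + 2 * ε) / (1 - 2 * ε) := by
    rw [div_eq_div_iff (by linarith) (by linarith)]; ring
  have e2 : (1 / 2 - ε) / (1 / 2 + ε) = ((1 + 2 * ε) / (1 - 2 * ε))⁻¹ := by
    rw [inv_div, div_eq_div_iff (by linarith) (by linarith)]; ring
  have hlog : Real.log ((1 + 2 * ε) / (1 - 2 * ε)) ≤ 5.02 * ε := by
    rw [Real.log_div (by linarith) (by linarith)]
    have h2 := Real.log_le_sub_one_of_pos (show 0 < 1 + 2 * ε by linarith)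
    have h3 := Real.one_sub_inv_le_log_of_pos (show 0 < 1 - 2 * ε by linarith)
    have h4 : (1 - 2 * ε)⁻¹ ≤ 1 + 3.02 * ε := by
      rw [inv_le_iff_one_le_mul₀ (by linarith)]
      nlinarith
    linarith
  rw [coinEntropy, e1, e2, Real.log_inv]
  nlinarith

/-- The chord of the convex function `4 ^ (-f)` over `[0, 1]`. -/
theorem exp_neg_log_four_mul_le {f : ℝ} (h0 : 0 ≤ f) (h1 : f ≤ 1) :
    Real.exp (-(2 * Real.log 2) * f) ≤ 1 - 3 / 4 * f := by
  have h := convexOn_exp.2 (Set.mem_univ 0) (Set.mem_univ (-(2 * Real.log 2)))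
    (sub_nonneg.2 h1) h0 (by ring)
  have e : Real.exp (-(2 * Real.log 2)) = 1 / 4 := by
    rw [Real.exp_neg, two_mul, Real.exp_add, Real.exp_log (by norm_num)]; norm_num
  simp only [smul_eq_mul, mul_zero, zero_add, Real.exp_zero, e] at h
  rw [mul_comm]
  linarith

namespace LeafTree

/-! ### The regret lower bound on the hard instances -/

variable {A N H : ℕ} (t : LeafTree A N H)

/-- The pair of the combined state space that belongs to a pair of the first graph. -/
def embed (y : Fin N × Fin A) : (Fin N ⊕ Fin (N + 1)) × Fin A := (Sum.inl y.1, y.2)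

theorem embed_injective : Function.Injective (embed : Fin N × Fin A → _) := by
  rintro ⟨j, a⟩ ⟨j', a'⟩ h
  simpa [embed] using h

/-- The biases of the reference instance: the arm `y₀` is fair, the other arms are worse. -/
def refBias (y₀ : Fin N × Fin A) (ε : ℝ) : (Fin N ⊕ Fin (N + 1)) × Fin A → ℝ :=
  fun x => if x = embed y₀ then 1 / 2 else 1 / 2 - ε

/-- The biases of the instance in which the arm `y` is the best one. -/
def altBias (y₀ : Fin N × Fin A) (ε : ℝ) (y : Fin N × Fin A) :
    (Fin N ⊕ Fin (N + 1)) × Fin A → ℝ :=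
  Function.update (refBias y₀ ε) (embed y) (1 / 2 + ε)

theorem refBias_mem (y₀ : Fin N × Fin A) {ε : ℝ} (h0 : 0 ≤ ε) (h1 : ε ≤ 1 / 2)
    (x : (Fin N ⊕ Fin (N + 1)) × Fin A) : refBias y₀ ε x ∈ Set.Icc (0 : ℝ) 1 := by
  rw [refBias]
  split_ifs <;> constructor <;> linarith

theorem altBias_mem (y₀ : Fin N × Fin A) {ε : ℝ} (h0 : 0 ≤ ε) (h1 : ε ≤ 1 / 2)
    (y : Fin N × Fin A) (x : (Fin N ⊕ Fin (N + 1)) × Fin A) :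
    altBias y₀ ε y x ∈ Set.Icc (0 : ℝ) 1 := by
  rw [altBias, Function.update_apply]
  split_ifs
  · constructor <;> linarith
  · exact refBias_mem y₀ h0 h1 x

/-- The smallest number of rewards that are at stake at a leaf. -/
def minStake : ℝ := (H : ℝ) - t.height - 1

theorem minStake_le_stake (j : Fin N) : t.minStake ≤ t.stake j := by
  rw [minStake, stake]
  have : (heapDepth A (t.inner + j) : ℝ) ≤ t.height := by
    have := t.depth_leaf j j.2
    exact_mod_cast (by omega : heapDepth A (t.inner + j) ≤ t.height)
  linarith

theorem horizon_le_minStake : (H : ℝ) ≤ 3 * t.minStake := by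
  have := t.height_lt
  rw [minStake]
  linarith

theorem minStake_pos : 0 < t.minStake := by
  have h1 := t.horizon_le_minStake
  have h2 := t.horizon_cast_pos
  linarith

variable {G₁ : Digraph (Fin N × Fin A)} {G₂ : Digraph (Fin (N + 1) × Fin A)}

/-- The visit of `x` reveals the coin of `y`. -/
def Reveals (G₁ : Digraph (Fin N × Fin A)) (G₂ : Digraph (Fin (N + 1) × Fin A))
    (x y : (Fin N ⊕ Fin (N + 1)) × Fin A) : Prop :=
  y = x ∨ (unionGraph G₁ G₂).Adj x y

theorem not_reveals_inr (k : Fin (N + 1)) (a : Fin A) (y : Fin N × Fin A) :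
    ¬ Reveals G₁ G₂ (Sum.inr k, a) (embed y) := by
  simp [Reveals, embed, unionGraph]

theorem Reveals.eq_of_isIndependent {Z : Finset (Fin N × Fin A)} (hZ : IsIndependent G₁ Z)
    {x y : Fin N × Fin A} (hx : x ∈ Z) (hy : y ∈ Z)
    (h : Reveals G₁ G₂ (embed x) (embed y)) : y = x := by
  rcases h with h | h
  · exact embed_injective h
  · by_contra hne
    exact hZ x hx y hy (Ne.symm hne) h

/-- In the reference instance, every observation of a coin other than that of `y₀` has a cost. -/
theorem le_expectedRegret_refBias {Z : Finset (Fin N × Fin A)} (hZ : IsIndependent G₁ Z)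
    {y₀ : Fin N × Fin A} (hy₀ : y₀ ∈ Z) {ε : ℝ} (h0 : 0 ≤ ε) (h1 : ε ≤ 1 / 2)
    (hε : ((Z.erase y₀).card : ℝ) * ε ≤ 1 / 2)
    (alg : Algorithm (Fin N ⊕ Fin (N + 1)) (Fin A)) (T : ℕ) :
    t.minStake * ε * ∑ y ∈ Z.erase y₀,
      ((t.hardMDP Z).strategy (unionGraph G₁ G₂) H alg).mean (refBias y₀ ε) (T * H)
        (obsCount (Reveals G₁ G₂) (embed y)) ≤
      ((t.hardMDP Z).toMDP (refBias_mem y₀ h0 h1)).expectedRegret (unionGraph G₁ G₂) H alg T := by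
  classical
  set π := (t.hardMDP Z).strategy (unionGraph G₁ G₂) H alg
  have hs := t.minStake_pos
  -- The price of a visit: `minStake * ε` for every coin of `Z.erase y₀` that it reveals.
  let κ : (Fin N ⊕ Fin (N + 1)) × Fin A → ℝ := fun x =>
    t.minStake * ε * ∑ y ∈ Z.erase y₀, if Reveals G₁ G₂ x (embed y) then 1 else 0
  -- Needed for pairs outside `Z`, which may reveal every coin, and for visits at a wrong time.
  have hκ_le : ∀ x, κ x ≤ t.baseValue := by
    intro x
    have h2 : ∑ y ∈ Z.erase y₀, (if Reveals G₁ G₂ x (embed y) then (1 : ℝ) else 0) ≤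
        (Z.erase y₀).card := by
      rw [Finset.card_eq_sum_ones, Nat.cast_sum]
      refine Finset.sum_le_sum fun y _ => ?_
      split_ifs <;> simp
    have h3 := mul_le_mul_of_nonneg_left h2 (mul_nonneg hs.le h0)
    have h4 := mul_le_mul_of_nonneg_left hε hs.le
    have h5 : t.minStake * (1 / 2) ≤ t.baseValue := by rw [minStake, baseValue]; linarith
    simp only [κ]
    linarith
  have hB := (t.hardMDP Z).mean_reward_le (refBias_mem y₀ h0 h1) (unionGraph G₁ G₂)
    t.horizon_pos alg t.potential (fun _ x => - κ x) t.potential_horizon_nonneg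
    (fun h hh x => t.potential_bellman Z (refBias_mem y₀ h0 h1) (κ := fun _ x => - κ x)
      (fun _ k a => by simp [κ, not_reveals_inr]) (fun _ j a => neg_le_neg (hκ_le _))
      (fun j a hja => by
        have hrev : ∀ y ∈ Z.erase y₀, Reveals G₁ G₂ (Sum.inl j, a) (embed y) → y = (j, a) :=
          fun y hy h => Reveals.eq_of_isIndependent hZ (x := (j, a)) hja
            (Finset.mem_of_mem_erase hy) h
        by_cases h : (j, a) = y₀
        · have h2 : refBias y₀ ε (Sum.inl j, a) = 1 / 2 := by simp [refBias, ← h, embed]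
          have h3 : κ (Sum.inl j, a) = 0 := by
            simp only [κ]
            rw [Finset.sum_eq_zero, mul_zero]
            intro y hy
            rw [if_neg]
            intro hr
            exact Finset.ne_of_mem_erase hy ((hrev y hy hr).trans h)
          rw [h2, h3]
          simp
        · have h2 : refBias y₀ ε (Sum.inl j, a) = 1 / 2 - ε := by
            rw [refBias, if_neg]
            exact fun e => h (embed_injective e)
          have h3 : κ (Sum.inl j, a) ≤ t.minStake * ε := by
            simp only [κ]
            refine (mul_le_mul_of_nonneg_left ?_ (mul_nonneg hs.le h0)).trans_eq (mul_one _)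
            rw [Finset.sum_eq_single_of_mem (j, a) (Finset.mem_erase.2 ⟨h, hja⟩)]
            · split_ifs <;> simp
            · intro y hy hne
              rw [if_neg]
              exact fun hr => hne (hrev y hy hr)
          have h4 := mul_le_mul_of_nonneg_right (t.minStake_le_stake j) h0
          rw [h2]
          linarith) hh x) T
  have hopt := t.baseValue_add_le_optimalReturn Z (refBias_mem y₀ h0 h1) (j := y₀.1) (a := y₀.2) hy₀
  have h2 : refBias y₀ ε (Sum.inl y₀.1, y₀.2) = 1 / 2 := by simp [refBias, embed]
  have hstart : t.potential 0 (t.hardMDP Z).start = t.baseValue := t.potential_start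
  have hmean : π.mean (refBias y₀ ε) (T * H) (fun ω => ∑ i, - κ (ω i).1) =
      - (t.minStake * ε * ∑ y ∈ Z.erase y₀,
        π.mean (refBias y₀ ε) (T * H) (obsCount (Reveals G₁ G₂) (embed y))) := by
    rw [← Strategy.mean_sum, ← Strategy.mean_mul_left, neg_eq_neg_one_mul,
      ← Strategy.mean_mul_left]
    congr 1
    funext ω
    rw [Finset.sum_neg_distrib, neg_one_mul, ← Finset.mul_sum, Finset.sum_comm]
    simp only [obsCount]
  rw [hstart, hmean] at hB
  rw [h2] at hopt
  rw [EpisodicMDP.expectedRegret, CoinMDP.integral_reward]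
  have := mul_le_mul_of_nonneg_left hopt (Nat.cast_nonneg (α := ℝ) T)
  linarith

open Classical in
/-- The number of episodes in which the arm `y` is visited at the time given by its depth. -/
def armCount (y : Fin N × Fin A) {T : ℕ}
    (ω : Traj ((Fin N ⊕ Fin (N + 1)) × Fin A) (T * H)) : ℝ :=
  ∑ i, if (ω i).1 = embed y ∧ (i : ℕ) % H = heapDepth A (t.inner + y.1) then 1 else 0

theorem armCount_nonneg (y : Fin N × Fin A) {T : ℕ}
    (ω : Traj ((Fin N ⊕ Fin (N + 1)) × Fin A) (T * H)) : 0 ≤ t.armCount y ω :=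
  Finset.sum_nonneg fun i _ => by split_ifs <;> simp

/-- The prescribed time leaves one step per episode; hence `armCount / T` lies in `[0, 1]`, as the
chord bound requires. -/
theorem armCount_le (y : Fin N × Fin A) {T : ℕ}
    (ω : Traj ((Fin N ⊕ Fin (N + 1)) × Fin A) (T * H)) : t.armCount y ω ≤ T := by
  classical
  calc t.armCount y ω
      ≤ ∑ i : Fin (T * H), if (i : ℕ) % H = heapDepth A (t.inner + y.1) then (1 : ℝ) else 0 := by
        refine Finset.sum_le_sum fun i _ => ?_
        split_ifs with h1 h2 h2
        · exact le_rfl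
        · exact absurd h1.2 h2
        · exact zero_le_one
        · exact le_rfl
    _ = ∑ _m : Fin T, ∑ h : Fin H, if (h : ℕ) = heapDepth A (t.inner + y.1) then (1 : ℝ) else 0 := by
        rw [← finProdFinEquiv.sum_comp, Fintype.sum_prod_type]
        refine Finset.sum_congr rfl fun m _ => Finset.sum_congr rfl fun h _ => ?_
        rw [finProdFinEquiv_apply_val, Nat.add_mul_mod_self_left, Nat.mod_eq_of_lt h.2]
    _ ≤ ∑ _m : Fin T, (1 : ℝ) := by
        refine Finset.sum_le_sum fun m _ => ?_
        rw [Finset.sum_boole]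
        norm_cast
        refine Finset.card_le_one.2 fun a ha b hb => Fin.ext ?_
        rw [(Finset.mem_filter.1 ha).2, (Finset.mem_filter.1 hb).2]
    _ = T := by simp

theorem armCount_le_obsCount (y : Fin N × Fin A) {T : ℕ}
    (ω : Traj ((Fin N ⊕ Fin (N + 1)) × Fin A) (T * H)) :
    t.armCount y ω ≤ obsCount (Reveals G₁ G₂) (embed y) ω := by
  refine Finset.sum_le_sum fun i _ => ?_
  by_cases h : (ω i).1 = embed y
  · have : Reveals G₁ G₂ (ω i).1 (embed y) := Or.inl h.symm
    rw [if_pos this]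
    split_ifs <;> simp
  · rw [if_neg fun h' => h h'.1]
    split_ifs <;> simp

/-- In the instance in which `y` is the best arm, every episode without a visit of `y` has a
cost. -/
theorem le_expectedRegret_altBias {Z : Finset (Fin N × Fin A)} {y₀ y : Fin N × Fin A}
    (hy : y ∈ Z) {ε : ℝ} (h0 : 0 ≤ ε) (h1 : ε ≤ 1 / 2)
    (alg : Algorithm (Fin N ⊕ Fin (N + 1)) (Fin A)) (T : ℕ) :
    t.minStake * ε * (T - ((t.hardMDP Z).strategy (unionGraph G₁ G₂) H alg).mean (altBias y₀ ε y)
      (T * H) (t.armCount y)) ≤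
      ((t.hardMDP Z).toMDP (altBias_mem y₀ h0 h1 y)).expectedRegret
        (unionGraph G₁ G₂) H alg T := by
  classical
  set π := (t.hardMDP Z).strategy (unionGraph G₁ G₂) H alg
  have hs := t.minStake_pos
  have hst := t.minStake_le_stake
  have hbias : altBias y₀ ε y (Sum.inl y.1, y.2) = 1 / 2 + ε := by simp [altBias, embed]
  have hgain : 0 ≤ t.stake y.1 * ε := mul_nonneg (hs.le.trans (hst _)) h0
  -- Only the arm `y`, at its proper time, can beat `baseValue`; every other arm has bias at most
  -- `1/2`.
  let κ : ℕ → (Fin N ⊕ Fin (N + 1)) × Fin A → ℝ := fun h x => t.stake y.1 * ε *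
    if x = embed y ∧ h = heapDepth A (t.inner + y.1) then 1 else 0
  have hκ : ∀ h x, 0 ≤ κ h x := fun h x => mul_nonneg hgain (by split_ifs <;> simp)
  have hB := (t.hardMDP Z).mean_reward_le (altBias_mem y₀ h0 h1 y) (unionGraph G₁ G₂)
    t.horizon_pos alg t.potential κ t.potential_horizon_nonneg
    (fun h hh x => t.potential_bellman Z (altBias_mem y₀ h0 h1 y) (κ := κ)
      (fun _ k a => hκ _ _) (fun _ j a => (neg_nonpos.2 t.baseValue_pos.le).trans (hκ _ _))
      (fun j a hja => by
        by_cases h : (j, a) = y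
        · subst h
          rw [hbias]
          simp [κ, embed]
        · have h2 : altBias y₀ ε y (Sum.inl j, a) ≤ 1 / 2 := by
            have hne : ((Sum.inl j, a) : (Fin N ⊕ Fin (N + 1)) × Fin A) ≠ embed y :=
              fun e => h (embed_injective e)
            rw [altBias, Function.update_of_ne hne, refBias]
            split_ifs <;> linarith
          refine le_trans (mul_nonpos_of_nonneg_of_nonpos (hs.le.trans (hst _)) ?_) (hκ _ _)
          linarith) hh x) T
  have hopt := t.baseValue_add_le_optimalReturn Z (altBias_mem y₀ h0 h1 y) (j := y.1) (a := y.2) hy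
  have hstart : t.potential 0 (t.hardMDP Z).start = t.baseValue := t.potential_start
  have hmean : π.mean (altBias y₀ ε y) (T * H) (fun ω => ∑ i : Fin (T * H), κ (i % H) (ω i).1) =
      t.stake y.1 * ε * π.mean (altBias y₀ ε y) (T * H) (t.armCount y) := by
    rw [← Strategy.mean_mul_left]
    congr 1
    funext ω
    rw [← Finset.mul_sum]
    rfl
  have hcount : π.mean (altBias y₀ ε y) (T * H) (t.armCount y) ≤ T :=
    (Strategy.mean_mono π (altBias_mem y₀ h0 h1 y) (t.armCount_le y)).trans_eq
      (Strategy.mean_const π _ _)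
  rw [hstart, hmean] at hB
  rw [hbias] at hopt
  rw [EpisodicMDP.expectedRegret, CoinMDP.integral_reward]
  have h2 := mul_le_mul_of_nonneg_left hopt (Nat.cast_nonneg (α := ℝ) T)
  have h3 := mul_le_mul_of_nonneg_right (mul_le_mul_of_nonneg_right (hst y.1) h0)
    (sub_nonneg.2 hcount)
  linarith

/-- An arm that is rarely observed in the reference instance is not visited in a third of the
episodes even if it is the best arm. -/
theorem mean_armCount_altBias_le {Z : Finset (Fin N × Fin A)} {y₀ y : Fin N × Fin A} (hne : y ≠ y₀)
    {ε : ℝ} (h0 : 0 < ε) (h1 : ε ≤ 0.1683) (alg : Algorithm (Fin N ⊕ Fin (N + 1)) (Fin A)) {T : ℕ}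
    (hT : 0 < T)
    (hobs : ((t.hardMDP Z).strategy (unionGraph G₁ G₂) H alg).mean (refBias y₀ ε) (T * H)
      (obsCount (Reveals G₁ G₂) (embed y)) ≤ 0.23062 * T)
    (hobs' : ε ^ 2 * ((t.hardMDP Z).strategy (unionGraph G₁ G₂) H alg).mean (refBias y₀ ε) (T * H)
      (obsCount (Reveals G₁ G₂) (embed y)) ≤ 0.0369) :
    ((t.hardMDP Z).strategy (unionGraph G₁ G₂) H alg).mean (altBias y₀ ε y) (T * H)
      (t.armCount y) ≤ 2 / 3 * T := by
  set π := (t.hardMDP Z).strategy (unionGraph G₁ G₂) H alg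
  have hT' : (0 : ℝ) < T := by exact_mod_cast hT
  have hε : ε ≤ 1 / 2 := h1.trans (by norm_num)
  have hπ : π.IsAdapted (Reveals G₁ G₂) := CoinMDP.strategy_isAdapted _ _ _ _
  have hq : refBias y₀ ε (embed y) = 1 / 2 - ε := by
    rw [refBias, if_neg fun e => hne (embed_injective e)]
  have hq' : altBias y₀ ε y (embed y) = 1 / 2 + ε := by simp [altBias]
  have hlt : ε < 1 / 2 := h1.trans_lt (by norm_num)
  have key := hπ.exp_mean_le (i := embed y) (n := T * H)
    (g := fun ω => -(2 * Real.log 2) * (t.armCount y ω / T))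
    (refBias_mem y₀ h0.le hε) (q' := altBias y₀ ε y)
    (fun x hx => Function.update_of_ne hx _ _)
    (by rw [hq]; constructor <;> linarith) (by rw [hq']; constructor <;> linarith)
    (fun ω ω' h => by
      have : t.armCount y ω = t.armCount y ω' := by
        simp only [armCount, (h _).1]
      rw [this])
  have hupper : π.mean (altBias y₀ ε y) (T * H)
      (fun ω => Real.exp (-(2 * Real.log 2) * (t.armCount y ω / T))) ≤
      1 - 3 / 4 * (π.mean (altBias y₀ ε y) (T * H) (t.armCount y) / T) := by
    refine (Strategy.mean_mono π (altBias_mem y₀ h0.le hε y) fun ω =>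
      exp_neg_log_four_mul_le (div_nonneg (t.armCount_nonneg y ω) hT'.le)
        ((div_le_one hT').2 (t.armCount_le y ω))).trans_eq ?_
    rw [Strategy.mean_sub, Strategy.mean_const, Strategy.mean_mul_left]
    simp only [div_eq_inv_mul _ (T : ℝ)]
    rw [Strategy.mean_mul_left]
  have hmean : π.mean (refBias y₀ ε) (T * H)
      (fun ω => -(2 * Real.log 2) * (t.armCount y ω / T)) =
      -(2 * Real.log 2) * (π.mean (refBias y₀ ε) (T * H) (t.armCount y) / T) := by
    rw [Strategy.mean_mul_left]
    simp only [div_eq_inv_mul _ (T : ℝ)]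
    rw [Strategy.mean_mul_left]
  have hcount : π.mean (refBias y₀ ε) (T * H) (t.armCount y) / T ≤ 0.23062 := by
    rw [div_le_iff₀ hT']
    exact (Strategy.mean_mono π (refBias_mem y₀ h0.le hε) (t.armCount_le_obsCount y)).trans hobs
  have hobs0 : 0 ≤ π.mean (refBias y₀ ε) (T * H) (obsCount (Reveals G₁ G₂) (embed y)) := by
    refine le_of_eq_of_le (Strategy.mean_const π (q := refBias y₀ ε) (T * H) 0).symm
      (Strategy.mean_mono π (refBias_mem y₀ h0.le hε) fun ω => ?_)
    exact (t.armCount_nonneg y ω).trans (t.armCount_le_obsCount y ω)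
  have hent := mul_le_mul_of_nonneg_right (coinEntropy_half_le h0 h1) hobs0
  rw [hmean, hq, hq'] at key
  have hlog := Real.log_two_gt_d9
  have hlog' := Real.log_two_lt_d9
  -- Numerically `2 * log 2 * 0.23062 + 10.04 * 0.0369 < log 2`. Against the chord bound, `1/2 ≤ 1 -
  -- 3/4 * f` gives `f ≤ 2/3`.
  have hhalf : (1 : ℝ) / 2 ≤ Real.exp (-(2 * Real.log 2) *
      (π.mean (refBias y₀ ε) (T * H) (t.armCount y) / T) - coinEntropy (1 / 2 - ε) (1 / 2 + ε) *
        π.mean (refBias y₀ ε) (T * H) (obsCount (Reveals G₁ G₂) (embed y))) := by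
    have e : (1 : ℝ) / 2 = Real.exp (-Real.log 2) := by
      rw [Real.exp_neg, Real.exp_log (by norm_num)]; norm_num
    refine e.trans_le (Real.exp_le_exp.2 ?_)
    have h2 := mul_le_mul_of_nonneg_left hcount (show 0 ≤ 2 * Real.log 2 by linarith)
    linarith
  have hfin := (hhalf.trans key).trans hupper
  have : π.mean (altBias y₀ ε y) (T * H) (t.armCount y) / T ≤ 2 / 3 := by linarith
  rwa [div_le_iff₀ hT'] at this

end LeafTree

theorem exists_isIndependent_card_eq {V : Type*} [Fintype V] (G : Digraph V) :
    ∃ s : Finset V, IsIndependent G s ∧ s.card = indepNumber G :=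
  Nat.sSup_mem (s := {n : ℕ | ∃ s : Finset V, IsIndependent G s ∧ s.card = n})
    ⟨0, ∅, by simp [IsIndependent], rfl⟩
    ⟨Fintype.card V, by rintro _ ⟨s, _, rfl⟩; exact Finset.card_le_univ s⟩

end FeedbackRL

end

/-! ### The lower bound -/

open FeedbackRL FeedbackRL.LeafTree in
theorem theorem3 (A N H T : ℕ) (hA : 2 ≤ A)
    (G₁ : Digraph (Fin N × Fin A)) (G₂ : Digraph (Fin (N + 1) × Fin A))
    (hH : 2 + 2 * Real.logb A N ≤ H)
    (hα : 2 ≤ FeedbackRL.indepNumber G₁)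
    (hT : (FeedbackRL.indepNumber G₁ : ℝ) ^ 3 / √2 ≤ T) :
    ∃ 𝓜 : Set (FeedbackRL.EpisodicMDP (Fin N ⊕ Fin (N + 1)) (Fin A)),
      ∀ alg : FeedbackRL.Algorithm (Fin N ⊕ Fin (N + 1)) (Fin A),
        ∃ M ∈ 𝓜, 1 / 46 * √(FeedbackRL.indepNumber G₁ * (H : ℝ) ^ 2 * T) ≤
          M.expectedRegret (FeedbackRL.unionGraph G₁ G₂) H alg T := by
  obtain ⟨Z, hZ, hcard⟩ := exists_isIndependent_card_eq G₁
  set K := indepNumber G₁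
  obtain ⟨y₀, hy₀⟩ : Z.Nonempty := Finset.card_pos.1 (by omega)
  obtain ⟨t⟩ := nonempty_leafTree hA y₀.1.pos hH
  have hK : (2 : ℝ) ≤ K := by exact_mod_cast hα
  have hT0 : (0 : ℝ) < T := lt_of_lt_of_le (by positivity) hT
  have hK3 : (K : ℝ) ^ 3 ≤ 1.41422 * T := cube_le_of_div_sqrt_two_le hT0 hT
  set ε := armGap K T
  have h0 : 0 < ε := armGap_pos hK hT0
  have h1 : ε ≤ 0.1683 := armGap_le hK hT0 hK3
  have h1' : ε ≤ 1 / 2 := h1.trans (by norm_num)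
  have hsq : ε ^ 2 * T = 4 / 25 * (K - 1) := armGap_sq_mul hK hT0
  have hcard' : ((Z.erase y₀).card : ℝ) = K - 1 := by
    rw [Finset.card_erase_of_mem hy₀, hcard, Nat.cast_sub (by omega), Nat.cast_one]
  have hs := t.minStake_pos
  -- `0.23062` exceeds `3 * 3.536 / 46`: the factor 3 is from `H ≤ 3 * minStake`, the other from
  -- `sqrt_mul_le_armGap`.
  have hbound : 1 / 46 * √(K * (H : ℝ) ^ 2 * T) ≤ t.minStake * (0.23062 * (ε * T)) := by
    have e : √(K * (H : ℝ) ^ 2 * T) = H * √(K * T) := by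
      rw [show (K : ℝ) * (H : ℝ) ^ 2 * T = (H : ℝ) ^ 2 * (K * T) by ring,
        Real.sqrt_mul (by positivity), Real.sqrt_sq (by positivity)]
    rw [e]
    have h2 := mul_le_mul t.horizon_le_minStake (sqrt_mul_le_armGap hK hT0)
      (Real.sqrt_nonneg _) (by linarith)
    have h3 : 0 ≤ t.minStake * (ε * T) := by positivity
    simp only [ε] at h3 ⊢
    linarith
  refine ⟨insert ((t.hardMDP Z).toMDP (refBias_mem y₀ h0.le h1'))
    {M | ∃ y ∈ Z.erase y₀, M = (t.hardMDP Z).toMDP (altBias_mem y₀ h0.le h1' y)}, fun alg => ?_⟩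
  by_cases hR : 1 / 46 * √(K * (H : ℝ) ^ 2 * T) ≤ ((t.hardMDP Z).toMDP
      (refBias_mem y₀ h0.le h1')).expectedRegret (unionGraph G₁ G₂) H alg T
  · exact ⟨_, Set.mem_insert _ _, hR⟩
  have href := t.le_expectedRegret_refBias (G₂ := G₂) hZ hy₀ h0.le h1'
    (by rw [hcard']; exact mul_armGap_le hK hT0 hK3) alg T
  set obs : Fin N × Fin A → ℝ := fun y =>
    ((t.hardMDP Z).strategy (unionGraph G₁ G₂) H alg).mean (refBias y₀ ε) (T * H)
      (obsCount (Reveals G₁ G₂) (embed y))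
  have hsum : ∑ y ∈ Z.erase y₀, obs y ≤ 0.23062 * T := by
    have h2 : t.minStake * ε * ∑ y ∈ Z.erase y₀, obs y ≤ t.minStake * ε * (0.23062 * T) := by
      linarith [href, (not_le.1 hR).le, hbound]
    exact le_of_mul_le_mul_left h2 (by positivity)
  -- Pigeonhole: the least observed of the `K - 1` arms is observed at most the average number of
  -- times.
  obtain ⟨y, hy, hyobs⟩ : ∃ y ∈ Z.erase y₀, (K - 1) * obs y ≤ 0.23062 * T := by
    by_contra! hcon
    have hne : (Z.erase y₀).Nonempty := by
      rw [← Finset.card_pos, Finset.card_erase_of_mem hy₀]; omega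
    have h2 := Finset.sum_lt_sum_of_nonempty hne hcon
    rw [Finset.sum_const, ← Finset.mul_sum, nsmul_eq_mul, hcard'] at h2
    have h3 := mul_le_mul_of_nonneg_left hsum (show (0 : ℝ) ≤ K - 1 by linarith)
    linarith
  have hobs0 : obs y ≤ 0.23062 * T := by
    rcases le_or_gt (obs y) 0 with h | h
    · exact h.trans (by positivity)
    · nlinarith
  -- By the choice of `ε`, `T` and `K` cancel and `4 / 25 * 0.23062` remains.
  have hobs' : ε ^ 2 * obs y ≤ 0.0369 := by
    have h2 : ε ^ 2 * obs y * T ≤ 0.0369 * T := by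
      calc ε ^ 2 * obs y * T = 4 / 25 * ((K - 1) * obs y) := by
            rw [mul_right_comm, hsq]; ring
        _ ≤ 0.0369 * T := by linarith
    exact le_of_mul_le_mul_right h2 hT0
  have hcount := t.mean_armCount_altBias_le (Finset.ne_of_mem_erase hy) h0 h1 alg
    (by exact_mod_cast hT0) hobs0 hobs'
  refine ⟨_, Set.mem_insert_of_mem _ ⟨y, hy, rfl⟩, hbound.trans ?_⟩
  refine le_trans ?_ (t.le_expectedRegret_altBias (G₂ := G₂) (Finset.mem_of_mem_erase hy) h0.le h1'
    alg T)
  -- At least `T / 3` episodes miss the best arm, more than is needed.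
  have h2 : 0.23062 * T ≤ T - ((t.hardMDP Z).strategy (unionGraph G₁ G₂) H alg).mean
      (altBias y₀ ε y) (T * H) (t.armCount y) := by linarith
  have h3 := mul_le_mul_of_nonneg_left h2 (mul_nonneg hs.le h0.le)
  linarith
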